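/- **Setting.** Let $P$ be a finite poset with minimum $\widehat 0$ and maximum $\widehat 1$, and let $\rho$ be a weak rank function on $P$, i.e. a function assigning to each pair $s\le t$ an integer $\rho_{st}\ge 0$, with $\rho_{st}>0$ if $s<t$ and $\rho_{st}=\rho_{sw}+\rho_{wt}$ if $s\le w\le t$. In the incidence algebra of $P$ over $\mathbb Z[x]$, with product $(ab)_{st}=\sum_{s\le w\le t}a_{sw}b_{wt}$ and identity $\delta$, let $\zeta_{st}=1$ for all $s\le t$ and $\mu=\zeta^{-1}$. For $a$ with $\deg a_{st}\le\rho_{st}$ for all $s\le t$, put $$(a^{\mathrm{rev}})_{st}(x)=x^{\rho_{st}}a_{st}(x^{-1}),\qquad (a^{\mathrm{sgn}})_{st}=(-1)^{\rho_{st}}a_{st}.$$ A kernel is an element $\kappa$ with $\deg\kappa_{st}\le\rho_{st}$, $\kappa_{ss}=1$ and $\kappa^{-1}=\kappa^{\mathrm{rev}}$. Its right Kazhdan–Lusztig–Stanley function is the unique $f$ with $f_{ss}=1$, $\deg f_{st}<\tfrac12\rho_{st}$ for $s<t$, and $\kappa=f^{\mathrm{rev}}f^{-1}$. Its Chow function is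 $\mathrm H=-(\overline\kappa)^{-1}$, where $\overline\kappa_{ss}=-1$ and $\overline\kappa_{st}=\kappa_{st}/(x-1)$ for $s<t$. Its right augmented Chow function is $\mathrm F=\mathrm H\cdot f^{\mathrm{rev}}$. Let $\chi=\mu\cdot\zeta^{\mathrm{rev}}$ be the characteristic function of $(P,\rho)$, which is a kernel; then $(\chi^{\mathrm{rev}})^{\mathrm{sgn}}$ is also a kernel. Let $\mathrm H^*$ and $\mathrm F^*$ be the Chow function and the right augmented Chow function of the kernel $(\chi^{\mathrm{rev}})^{\mathrm{sgn}}$. For a matroid $\mathsf M$ on a finite ground set, take $P$ to be its lattice of flats ordered by inclusion, with $\rho_{FG}=\operatorname{rk}G-\operatorname{rk}F$. The dual Chow polynomial of $\mathsf M$ is $\mathrm H^*_{\mathsf M}(x)=\mathrm H^*_{\widehat 0\,\widehat 1}(x)$, and the dual augmented Chow polynomial of $\mathsf M$ is $\mathrm F^*_{\mathsf M}(x)=\mathrm F^*_{\widehat 0\,\widehat 1}(x)$. **Corollary.** Let $0\le r\le n$ be integers, and let $\mathsf U_{r,n}$ be the uniform matroid on $n$ elements whose independent sets are the subsets with at most $r$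 elements. Then the dual Chow polynomial $\mathrm H^*_{\mathsf U_{r,n}}(x)$ and the dual augmented Chow polynomial $\mathrm F^*_{\mathsf U_{r,n}}(x)$ are both real-rooted: they are nonzero, and all their complex roots are real. -/

import Mathlib

noncomputable section

namespace DualChow

open Polynomial Finset

/-! ### Weakly ranked posets and operations on their incidence algebras

The incidence algebra with coefficients in `ℤ[X]` is Mathlib's `IncidenceAlgebra ℤ[X] P`, whose
product is the convolution product. -/

/-- A weak rank function on a poset: every interval `[s, t]` gets a natural number, positive if
`s < t`, and additive along `s ≤ w ≤ t`. Only the values at pairs `s ≤ t` matter. -/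
structure WeakRank (P : Type*) [PartialOrder P] where
  rk : P → P → ℕ
  pos : ∀ {s t : P}, s < t → 0 < rk s t
  add : ∀ {s w t : P}, s ≤ w → w ≤ t → rk s t = rk s w + rk w t

section Incidence

variable {P : Type*} [PartialOrder P]

/-- The reversal `a ↦ a^rev`, `(a^rev)_{st}(x) = x^{ρ_{st}} a_{st}(x⁻¹)`
(for `deg a_{st} ≤ ρ_{st}`). -/
def rev (ρ : WeakRank P) (a : IncidenceAlgebra ℤ[X] P) : IncidenceAlgebra ℤ[X] P where
  toFun s t := (a s t).reflect (ρ.rk s t)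
  eq_zero_of_not_le' s t h := by
    rw [IncidenceAlgebra.apply_eq_zero_of_not_le h, reflect_zero]

/-- The sign twist `(a^sgn)_{st} = (-1)^{ρ_{st}} a_{st}`. -/
def sgn (ρ : WeakRank P) (a : IncidenceAlgebra ℤ[X] P) : IncidenceAlgebra ℤ[X] P where
  toFun s t := (-1) ^ ρ.rk s t * a s t
  eq_zero_of_not_le' s t h := by
    rw [IncidenceAlgebra.apply_eq_zero_of_not_le h, mul_zero]

variable [DecidableEq P]

/-- The element `κ̄`: `κ̄_{ss} = -1`, and `κ̄_{st} = κ_{st} / (x - 1)` for `s < t`. -/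
def bar (κ : IncidenceAlgebra ℤ[X] P) : IncidenceAlgebra ℤ[X] P where
  toFun s t := if s = t then -1 else κ s t /ₘ (X - C 1)
  eq_zero_of_not_le' s t h := by
    rw [if_neg (fun e => h e.le), IncidenceAlgebra.apply_eq_zero_of_not_le h, zero_divByMonic]

variable [LocallyFiniteOrder P]

/-- The Chow function of a kernel `κ`: `H = -(κ̄)⁻¹`. -/
def chow (κ : IncidenceAlgebra ℤ[X] P) : IncidenceAlgebra ℤ[X] P :=
  -Ring.inverse (bar κ)

/-- `κ` is a kernel: `deg κ_{st} ≤ ρ_{st}`, `κ_{ss} = 1`, and `κ^rev` is inverse to `κ`. -/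
structure IsKernel (ρ : WeakRank P) (κ : IncidenceAlgebra ℤ[X] P) : Prop where
  natDegree_le : ∀ s t, s ≤ t → (κ s t).natDegree ≤ ρ.rk s t
  diag : ∀ s, κ s s = 1
  mul_rev : κ * rev ρ κ = 1
  rev_mul : rev ρ κ * κ = 1

/-- `f` is the right Kazhdan-Lusztig-Stanley function of `κ`: `f_{ss} = 1`,
`deg f_{st} < ρ_{st} / 2` for `s < t`, and `κ = f^rev f⁻¹`. -/
structure IsRightKLS (ρ : WeakRank P) (κ f : IncidenceAlgebra ℤ[X] P) : Prop where
  diag : ∀ s, f s s = 1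
  natDegree_lt : ∀ s t, s < t → 2 * (f s t).natDegree < ρ.rk s t
  eq_mul : κ = rev ρ f * Ring.inverse f

open Classical in
/-- The right Kazhdan-Lusztig-Stanley function of a kernel `κ` (with value `0` if there is none).
See `IsRightKLS.unique` and `isRightKLS_rightKLS_dualKernel_chi` below. -/
def rightKLS (ρ : WeakRank P) (κ : IncidenceAlgebra ℤ[X] P) : IncidenceAlgebra ℤ[X] P :=
  if h : ∃ f, IsRightKLS ρ κ f then h.choose else 0

/-- The right augmented Chow function of a kernel: `F = H f^rev`. -/
def rightAugChow (ρ : WeakRank P) (κ : IncidenceAlgebra ℤ[X] P) : IncidenceAlgebra ℤ[X] P :=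
  chow κ * rev ρ (rightKLS ρ κ)

/-- The kernel `(κ^rev)^sgn`, which defines the dual invariants of `κ`. -/
def dualKernel (ρ : WeakRank P) (κ : IncidenceAlgebra ℤ[X] P) : IncidenceAlgebra ℤ[X] P :=
  sgn ρ (rev ρ κ)

variable [DecidableLE P]

/-- The characteristic function `χ = μ ζ^rev`. -/
def chi (ρ : WeakRank P) : IncidenceAlgebra ℤ[X] P :=
  IncidenceAlgebra.mu ℤ[X] * rev ρ (IncidenceAlgebra.zeta ℤ[X])

/-- The dual Chow function `H*` of a weakly ranked poset (for the characteristic kernel). -/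
def dualChow (ρ : WeakRank P) : IncidenceAlgebra ℤ[X] P :=
  chow (dualKernel ρ (chi ρ))

/-- The dual (right) augmented Chow function `F*` of a weakly ranked poset (for the
characteristic kernel). -/
def dualAugChow (ρ : WeakRank P) : IncidenceAlgebra ℤ[X] P :=
  rightAugChow ρ (dualKernel ρ (chi ρ))

end Incidence

/-! ### The inverses, the division by `x - 1` and the KLS function above exist -/

section WellDefined

variable {P : Type*} [PartialOrder P]

theorem WeakRank.self (ρ : WeakRank P) (s : P) : ρ.rk s s = 0 := by
  have := ρ.add (le_refl s) (le_refl s)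
  omega

theorem rev_rev (ρ : WeakRank P) (a : IncidenceAlgebra ℤ[X] P) : rev ρ (rev ρ a) = a := by
  refine IncidenceAlgebra.ext fun s t hst => ?_
  simp [rev]

theorem rev_sgn (ρ : WeakRank P) (a : IncidenceAlgebra ℤ[X] P) :
    rev ρ (sgn ρ a) = sgn ρ (rev ρ a) := by
  refine IncidenceAlgebra.ext fun s t hst => ?_
  have : ((-1 : ℤ[X]) ^ ρ.rk s t) = C ((-1) ^ ρ.rk s t) := by simp
  simp only [rev, sgn, IncidenceAlgebra.coe_mk, this, reflect_C_mul]

theorem natDegree_sgn (ρ : WeakRank P) (a : IncidenceAlgebra ℤ[X] P) (s t : P) :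
    (sgn ρ a s t).natDegree = (a s t).natDegree := by
  simp only [sgn, IncidenceAlgebra.coe_mk]
  rcases neg_one_pow_eq_or ℤ[X] (ρ.rk s t) with h | h <;> simp [h]

theorem natDegree_rev_le (ρ : WeakRank P) (a : IncidenceAlgebra ℤ[X] P)
    (ha : ∀ s t, s ≤ t → (a s t).natDegree ≤ ρ.rk s t) (s t : P) (h : s ≤ t) :
    (rev ρ a s t).natDegree ≤ ρ.rk s t := by
  simp only [rev, IncidenceAlgebra.coe_mk]
  exact natDegree_reflect_le.trans (max_le le_rfl (ha s t h))

theorem natDegree_zeta [DecidableLE P] (s t : P) : (IncidenceAlgebra.zeta ℤ[X] s t).natDegree = 0 := by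
  rw [IncidenceAlgebra.zeta_apply]
  split_ifs <;> simp

theorem rev_one [DecidableEq P] (ρ : WeakRank P) : rev ρ 1 = 1 := by
  refine IncidenceAlgebra.ext fun s t hst => ?_
  rcases eq_or_ne s t with rfl | h
  · simp [rev, ρ.self]
  · simp [rev, h]

theorem sgn_one [DecidableEq P] (ρ : WeakRank P) : sgn ρ 1 = 1 := by
  refine IncidenceAlgebra.ext fun s t hst => ?_
  rcases eq_or_ne s t with rfl | h
  · simp [sgn, ρ.self]
  · simp [sgn, h]

theorem sgn_mul [LocallyFiniteOrder P] (ρ : WeakRank P) (a b : IncidenceAlgebra ℤ[X] P) :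
    sgn ρ (a * b) = sgn ρ a * sgn ρ b := by
  refine IncidenceAlgebra.ext fun s t hst => ?_
  simp only [sgn, IncidenceAlgebra.mul_apply, IncidenceAlgebra.coe_mk, mul_sum]
  refine sum_congr rfl fun w hw => ?_
  rw [mem_Icc] at hw
  rw [ρ.add hw.1 hw.2, pow_add]
  ring

variable [LocallyFiniteOrder P] [DecidableEq P]

def leftInvFun (a : IncidenceAlgebra ℤ[X] P) (s : P) : P → ℤ[X]
  | t => ((if s = t then 1 else 0) - ∑ w ∈ (Ico s t).attach,
      have : (Icc s w.1).card < (Icc s t).card :=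
        card_lt_card (Icc_ssubset_Icc_right
          ((mem_Ico.1 w.2).1.trans (mem_Ico.1 w.2).2.le) le_rfl (mem_Ico.1 w.2).2)
      leftInvFun a s w.1 * a w.1 t) * Ring.inverse (a t t)
termination_by t => (Icc s t).card

theorem leftInvFun_apply (a : IncidenceAlgebra ℤ[X] P) (s t : P) :
    leftInvFun a s t = ((if s = t then 1 else 0) - ∑ w ∈ Ico s t, leftInvFun a s w * a w t)
      * Ring.inverse (a t t) := by
  rw [leftInvFun, ← sum_attach (Ico s t)]

theorem exists_left_inverse (a : IncidenceAlgebra ℤ[X] P) (h : ∀ s, IsUnit (a s s)) :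
    ∃ b : IncidenceAlgebra ℤ[X] P, b * a = 1 ∧ ∀ s, IsUnit (b s s) := by
  refine ⟨⟨leftInvFun a, fun s t hst => ?_⟩, ?_, fun s => ?_⟩
  · rw [leftInvFun_apply, if_neg (fun e => hst e.le),
      Ico_eq_empty (fun e => hst e.le)]
    simp
  · refine IncidenceAlgebra.ext fun s t hst => ?_
    simp only [IncidenceAlgebra.mul_apply, IncidenceAlgebra.coe_mk, IncidenceAlgebra.one_apply]
    rw [Icc_eq_cons_Ico hst, sum_cons, leftInvFun_apply, mul_assoc,
      Ring.inverse_mul_cancel _ (h t), mul_one, sub_add_cancel]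
  · simp only [IncidenceAlgebra.coe_mk]
    rw [leftInvFun_apply]
    simpa using h s

/-- An element of the incidence algebra is invertible as soon as its diagonal entries are. -/
theorem isUnit_of_diag (a : IncidenceAlgebra ℤ[X] P) (h : ∀ s, IsUnit (a s s)) : IsUnit a := by
  obtain ⟨b, hb, hb'⟩ := exists_left_inverse a h
  obtain ⟨c, hc, -⟩ := exists_left_inverse b hb'
  have : c = a := left_inv_eq_right_inv hc hb
  exact ⟨⟨a, b, this ▸ hc, hb⟩, rfl⟩

theorem isUnit_bar (κ : IncidenceAlgebra ℤ[X] P) : IsUnit (bar κ) :=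
  isUnit_of_diag _ fun s => by simp [bar]

theorem IsRightKLS.isUnit {ρ : WeakRank P} {κ f : IncidenceAlgebra ℤ[X] P}
    (h : IsRightKLS ρ κ f) : IsUnit f :=
  isUnit_of_diag _ fun s => by simp [h.diag]

/-- The right KLS function is unique. -/
theorem IsRightKLS.unique {ρ : WeakRank P} {κ f g : IncidenceAlgebra ℤ[X] P}
    (hf : IsRightKLS ρ κ f) (hg : IsRightKLS ρ κ g) : f = g := by
  have ef : κ * f = rev ρ f := by
    rw [hf.eq_mul, mul_assoc, Ring.inverse_mul_cancel _ hf.isUnit, mul_one]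
  have eg : κ * g = rev ρ g := by
    rw [hg.eq_mul, mul_assoc, Ring.inverse_mul_cancel _ hg.isUnit, mul_one]
  have key : ∀ n : ℕ, ∀ s t : P, s ≤ t → ρ.rk s t = n → f s t = g s t := by
    intro n
    induction n using Nat.strong_induction_on with
    | _ n ih =>
      intro s t hst hn
      rcases hst.eq_or_lt with rfl | hlt
      · rw [hf.diag, hg.diag]
      have hκ : κ s s = 1 := by
        have := congrArg (fun a : IncidenceAlgebra ℤ[X] P => a s s) ef
        simpa [rev, hf.diag, ρ.self] using this
      have h1 := congrArg (fun a : IncidenceAlgebra ℤ[X] P => a s t) ef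
      have h2 := congrArg (fun a : IncidenceAlgebra ℤ[X] P => a s t) eg
      simp only [IncidenceAlgebra.mul_apply, rev, IncidenceAlgebra.coe_mk] at h1 h2
      rw [Icc_eq_cons_Ioc hst, sum_cons, hκ, one_mul] at h1 h2
      have h3 : ∑ w ∈ Ioc s t, κ s w * f w t = ∑ w ∈ Ioc s t, κ s w * g w t := by
        refine sum_congr rfl fun w hw => ?_
        rw [mem_Ioc] at hw
        have ha := ρ.add hw.1.le hw.2
        have hp := ρ.pos hw.1
        rw [ih (ρ.rk w t) (by omega) w t hw.2 rfl]
      have h4 : f s t - g s t = (f s t - g s t).reflect (ρ.rk s t) := by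
        rw [reflect_sub, ← h1, ← h2, h3]
        ring
      have hd : 2 * (f s t - g s t).natDegree < ρ.rk s t := by
        have := natDegree_sub_le (f s t) (g s t)
        have a1 := hf.natDegree_lt s t hlt
        have a2 := hg.natDegree_lt s t hlt
        omega
      rw [← sub_eq_zero]
      ext i
      rw [coeff_zero]
      by_cases hi : (f s t - g s t).natDegree < i
      · exact coeff_eq_zero_of_natDegree_lt hi
      · rw [h4, coeff_reflect, revAt_le (by omega)]
        exact coeff_eq_zero_of_natDegree_lt (by omega)
  refine IncidenceAlgebra.ext fun s t hst => ?_
  exact key _ s t hst rfl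

theorem rev_mul {ρ : WeakRank P} {a b : IncidenceAlgebra ℤ[X] P}
    (ha : ∀ s t, s ≤ t → (a s t).natDegree ≤ ρ.rk s t)
    (hb : ∀ s t, s ≤ t → (b s t).natDegree ≤ ρ.rk s t) :
    rev ρ (a * b) = rev ρ a * rev ρ b := by
  have hs : ∀ (N : ℕ) (S : Finset P) (F : P → ℤ[X]),
      (∑ w ∈ S, F w).reflect N = ∑ w ∈ S, (F w).reflect N := by
    classical
    intro N S F
    induction S using Finset.induction_on with
    | empty => simp
    | insert w S hw ih => rw [sum_insert hw, sum_insert hw, reflect_add, ih]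
  refine IncidenceAlgebra.ext fun s t hst => ?_
  simp only [rev, IncidenceAlgebra.mul_apply, IncidenceAlgebra.coe_mk, hs]
  refine sum_congr rfl fun w hw => ?_
  rw [mem_Icc] at hw
  rw [ρ.add hw.1 hw.2, reflect_mul _ _ (ha s w hw.1) (hb w t hw.2)]

theorem natDegree_mu (s t : P) : (IncidenceAlgebra.mu ℤ[X] s t).natDegree = 0 := by
  have key : ∀ n : ℕ, ∀ t : P, (Icc s t).card = n →
      (IncidenceAlgebra.mu ℤ[X] s t).natDegree = 0 := by
    intro n
    induction n using Nat.strong_induction_on with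
    | _ n ih =>
      intro t hn
      rw [IncidenceAlgebra.mu_apply]
      split_ifs with h
      · simp
      · rw [natDegree_neg, ← Nat.le_zero]
        refine natDegree_sum_le_of_forall_le _ _ fun w hw => ?_
        rw [mem_Ico] at hw
        exact (ih _ (hn ▸ card_lt_card (Icc_ssubset_Icc_right
          (hw.1.trans hw.2.le) le_rfl hw.2)) w rfl).le
  exact key _ t rfl

variable [DecidableLE P]

theorem dualKernel_chi (ρ : WeakRank P) :
    dualKernel ρ (chi ρ) = sgn ρ (rev ρ (IncidenceAlgebra.mu ℤ[X]))
      * sgn ρ (IncidenceAlgebra.zeta ℤ[X]) := by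
  have hz : ∀ s t : P, s ≤ t → (IncidenceAlgebra.zeta ℤ[X] s t).natDegree ≤ ρ.rk s t :=
    fun s t _ => by simp only [natDegree_zeta]; omega
  rw [dualKernel, chi, rev_mul (fun s t _ => by simp [natDegree_mu])
    (natDegree_rev_le ρ _ hz), rev_rev, sgn_mul]

theorem sgn_mu_mul_sgn_zeta (ρ : WeakRank P) :
    sgn ρ (IncidenceAlgebra.mu ℤ[X]) * sgn ρ (IncidenceAlgebra.zeta ℤ[X])
      = (1 : IncidenceAlgebra ℤ[X] P) := by
  rw [← sgn_mul, IncidenceAlgebra.mu_mul_zeta, sgn_one]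

theorem sgn_zeta_mul_sgn_mu (ρ : WeakRank P) :
    sgn ρ (IncidenceAlgebra.zeta ℤ[X]) * sgn ρ (IncidenceAlgebra.mu ℤ[X])
      = (1 : IncidenceAlgebra ℤ[X] P) := by
  rw [← sgn_mul, IncidenceAlgebra.zeta_mul_mu, sgn_one]

theorem isRightKLS_sgn_mu (ρ : WeakRank P) :
    IsRightKLS ρ (dualKernel ρ (chi ρ)) (sgn ρ (IncidenceAlgebra.mu ℤ[X])) where
  diag s := by simp [sgn, ρ.self]
  natDegree_lt s t h := by
    rw [natDegree_sgn, natDegree_mu]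
    simpa using ρ.pos h
  eq_mul := by
    have : Ring.inverse (sgn ρ (IncidenceAlgebra.mu ℤ[X]) : IncidenceAlgebra ℤ[X] P)
        = sgn ρ (IncidenceAlgebra.zeta ℤ[X]) :=
      Ring.inverse_unit ⟨_, _, sgn_mu_mul_sgn_zeta ρ, sgn_zeta_mul_sgn_mu ρ⟩
    rw [this, dualKernel_chi, rev_sgn]

/-- The right KLS function used in the definition of the dual augmented Chow function exists. -/
theorem isRightKLS_rightKLS_dualKernel_chi (ρ : WeakRank P) :
    IsRightKLS ρ (dualKernel ρ (chi ρ)) (rightKLS ρ (dualKernel ρ (chi ρ))) := by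
  have h : ∃ f, IsRightKLS ρ (dualKernel ρ (chi ρ)) f := ⟨_, isRightKLS_sgn_mu ρ⟩
  rw [rightKLS, dif_pos h]
  exact h.choose_spec

/-- The kernel `(χ^rev)^sgn` is indeed a kernel. -/
theorem isKernel_dualKernel_chi (ρ : WeakRank P) : IsKernel ρ (dualKernel ρ (chi ρ)) := by
  have hm : ∀ s t : P, s ≤ t →
      (sgn ρ (IncidenceAlgebra.mu ℤ[X]) s t).natDegree ≤ ρ.rk s t :=
    fun s t _ => by rw [natDegree_sgn, natDegree_mu]; omega
  have hz : ∀ s t : P, s ≤ t →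
      (sgn ρ (IncidenceAlgebra.zeta ℤ[X]) s t).natDegree ≤ ρ.rk s t :=
    fun s t _ => by rw [natDegree_sgn, natDegree_zeta]; omega
  have e1 : dualKernel ρ (chi ρ) = rev ρ (sgn ρ (IncidenceAlgebra.mu ℤ[X]))
      * sgn ρ (IncidenceAlgebra.zeta ℤ[X]) := by
    rw [dualKernel_chi, rev_sgn]
  have e2 : rev ρ (dualKernel ρ (chi ρ)) = sgn ρ (IncidenceAlgebra.mu ℤ[X])
      * rev ρ (sgn ρ (IncidenceAlgebra.zeta ℤ[X])) := by
    rw [e1, rev_mul (natDegree_rev_le ρ _ hm) hz, rev_rev]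
  have r1 : rev ρ (sgn ρ (IncidenceAlgebra.mu ℤ[X]))
      * rev ρ (sgn ρ (IncidenceAlgebra.zeta ℤ[X])) = (1 : IncidenceAlgebra ℤ[X] P) := by
    rw [← rev_mul hm hz, sgn_mu_mul_sgn_zeta, rev_one]
  have r2 : rev ρ (sgn ρ (IncidenceAlgebra.zeta ℤ[X]))
      * rev ρ (sgn ρ (IncidenceAlgebra.mu ℤ[X])) = (1 : IncidenceAlgebra ℤ[X] P) := by
    rw [← rev_mul hz hm, sgn_zeta_mul_sgn_mu, rev_one]
  refine ⟨fun s t hst => ?_, fun s => ?_, ?_, ?_⟩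
  · rw [e1, IncidenceAlgebra.mul_apply]
    refine natDegree_sum_le_of_forall_le _ _ fun w hw => ?_
    rw [mem_Icc] at hw
    rw [ρ.add hw.1 hw.2]
    exact natDegree_mul_le.trans
      (add_le_add (natDegree_rev_le ρ _ hm s w hw.1) (hz w t hw.2))
  · rw [e1]
    simp [rev, sgn, ρ.self]
  · rw [e2, e1, mul_assoc, ← mul_assoc (sgn ρ (IncidenceAlgebra.zeta ℤ[X])),
      sgn_zeta_mul_sgn_mu, one_mul, r1]
  · rw [e2, e1, mul_assoc, ← mul_assoc (rev ρ (sgn ρ (IncidenceAlgebra.zeta ℤ[X]))), r2,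
      one_mul, sgn_mu_mul_sgn_zeta]

/-- The division by `x - 1` in the definition of the dual Chow function is exact. -/
theorem mul_bar_dualKernel_chi (ρ : WeakRank P) {s t : P} (h : s < t) :
    (X - C 1) * bar (dualKernel ρ (chi ρ)) s t = dualKernel ρ (chi ρ) s t := by
  simp only [bar, IncidenceAlgebra.coe_mk, if_neg h.ne]
  rw [mul_divByMonic_eq_iff_isRoot, IsRoot.def, dualKernel_chi, IncidenceAlgebra.mul_apply,
    eval_finsetSum]
  have hr : ∀ (N : ℕ) (p : ℤ[X]), (p.reflect N).eval 1 = p.eval 1 := by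
    intro N p
    rw [eval_eq_sum_range' (Nat.lt_succ_of_le (le_max_right N p.natDegree)),
      eval_eq_sum_range' (Nat.lt_succ_of_le (natDegree_reflect_le (N := N) (p := p)))]
    simp only [one_pow, mul_one, coeff_reflect]
    have hle : ∀ i ∈ range (max N p.natDegree).succ,
        revAt N i ∈ range (max N p.natDegree).succ := by
      intro i hi
      rw [mem_range] at hi ⊢
      rcases le_or_gt i N with h | h
      · rw [revAt_le h]; omega
      · rwa [revAt_eq_self_of_lt h]
    exact sum_nbij' (revAt N) (revAt N) hle hle (fun _ _ => revAt_invol)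
      (fun _ _ => revAt_invol) (fun _ _ => rfl)
  have hsum : ∑ w ∈ Icc s t, (IncidenceAlgebra.mu ℤ[X] s w).eval 1 = 0 := by
    have := IncidenceAlgebra.sum_Icc_mu_right (𝕜 := ℤ[X]) s t
    rw [if_neg h.ne] at this
    rw [← eval_finsetSum, this, eval_zero]
  calc _ = ∑ w ∈ Icc s t, (-1) ^ ρ.rk s t * (IncidenceAlgebra.mu ℤ[X] s w).eval 1 := by
        refine sum_congr rfl fun w hw => ?_
        rw [mem_Icc] at hw
        simp only [sgn, rev, IncidenceAlgebra.coe_mk, IncidenceAlgebra.zeta_apply, if_pos hw.2]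
        rw [ρ.add hw.1 hw.2, pow_add]
        simp only [eval_mul, eval_pow, eval_neg, eval_one, hr]
        ring
    _ = 0 := by rw [← mul_sum, hsum, mul_zero]

end WellDefined

/-! ### Matroids -/

section Matroids

variable {α : Type*}

/-- The lattice of flats of a matroid, ordered by inclusion. -/
abbrev Flats (M : Matroid α) : Type _ := {F : Set α // M.IsFlat F}

instance (M : Matroid α) : BoundedOrder (Flats M) where
  top := ⟨M.E, M.ground_isFlat⟩
  le_top F := F.2.subset_ground
  bot := ⟨M.closure ∅, M.isFlat_closure ∅⟩
  bot_le F := (M.closure_subset_closure (Set.empty_subset F.1)).trans F.2.closure.le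

instance (M : Matroid α) [M.Finite] : Finite (Flats M) :=
  (M.ground_finite.finite_subsets.subset fun _ hF => hF.subset_ground :
    {F : Set α | M.IsFlat F}.Finite).to_subtype

/-- The rank function of the lattice of flats: `ρ_{FG} = rk G - rk F`. -/
def flatsRank (M : Matroid α) [M.Finite] : WeakRank (Flats M) where
  rk F G := (M.eRk G.1).toNat - (M.eRk F.1).toNat
  pos {F G} h := by
    have hF : M.eRk F.1 ≠ ⊤ := Matroid.eRk_ne_top_iff.2 (M.isRkFinite_set F.1)
    have hG : M.eRk G.1 ≠ ⊤ := Matroid.eRk_ne_top_iff.2 (M.isRkFinite_set G.1)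
    have hlt : M.eRk F.1 < M.eRk G.1 := by
      refine lt_of_not_ge fun hle => h.ne ?_
      have := (M.isRkFinite_set F.1).closure_eq_closure_of_subset_of_eRk_ge_eRk h.le hle
      rw [F.2.closure, G.2.closure] at this
      exact Subtype.ext this
    rw [← ENat.natCast_toNat hF, ← ENat.natCast_toNat hG, Nat.cast_lt] at hlt
    omega
  add {F H G} h1 h2 := by
    have hH : M.eRk H.1 ≠ ⊤ := Matroid.eRk_ne_top_iff.2 (M.isRkFinite_set H.1)
    have hG : M.eRk G.1 ≠ ⊤ := Matroid.eRk_ne_top_iff.2 (M.isRkFinite_set G.1)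
    have a1 := ENat.toNat_le_toNat (M.eRk_mono h1) hH
    have a2 := ENat.toNat_le_toNat (M.eRk_mono h2) hG
    omega

instance (M : Matroid α) [M.Finite] : LocallyFiniteOrder (Flats M) :=
  letI := Fintype.ofFinite (Flats M)
  letI : DecidableLE (Flats M) := Classical.decRel _
  letI : DecidableLT (Flats M) := Classical.decRel _
  Fintype.toLocallyFiniteOrder

open Classical in
/-- The dual Chow polynomial `H*_M(x)` of a matroid: the value of the dual Chow function of the
lattice of flats on the whole lattice. -/
def dualChowPolynomial (M : Matroid α) [M.Finite] : ℤ[X] :=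
  dualChow (flatsRank M) ⊥ ⊤

open Classical in
/-- The dual augmented Chow polynomial `F*_M(x)` of a matroid. -/
def dualAugChowPolynomial (M : Matroid α) [M.Finite] : ℤ[X] :=
  dualAugChow (flatsRank M) ⊥ ⊤

/-- The uniform matroid `U_{r,n}` on `n` elements, for `r ≤ n`: a set is independent if and only
if it has at most `r` elements. -/
def uniformMatroid (r n : ℕ) : Matroid (Fin n) :=
  (IndepMatroid.ofFinite (E := Set.univ) Set.finite_univ (fun I => I.ncard ≤ r)
    (by simp)
    (fun _ J hJ hIJ => (Set.ncard_le_ncard hIJ J.toFinite).trans hJ)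
    (fun I J _ hJ hIJ => by
      obtain ⟨e, he, he'⟩ := Set.exists_mem_notMem_of_ncard_lt_ncard hIJ
      refine ⟨e, he, he', ?_⟩
      rw [Set.ncard_insert_of_notMem he']
      omega)
    (fun _ _ => Set.subset_univ _)).matroid

instance (r n : ℕ) : (uniformMatroid r n).Finite := ⟨Set.toFinite _⟩

end Matroids

/-- A polynomial is real-rooted if all its complex roots are real. (In this form, the zero
polynomial is not real-rooted.) -/
def RealRooted (p : ℤ[X]) : Prop :=
  ∀ z : ℂ, aeval z p = 0 → z.im = 0

end DualChow

end

/-!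
# Real-rootedness of the dual Chow polynomials of uniform matroids

Below its top, the lattice of flats of the uniform matroid is Boolean, and there the dual Chow
function is given by the Eulerian polynomials `A k`. The recursion `sum_dualChow_mul`, in which the
right Kazhdan–Lusztig–Stanley function is the signed Möbius function, then computes the value at the
top. Let `L` be the linear functional `umbral x` with `L (t ^ k) = A k`. For rank `N + 1` on
`N + 1 + d` elements, with `w i = C(d + i, i)` and
* `E = ∑ i, w i * L (t ^ (N - i) * (t + x) ^ i)`,
* `E^rev = ∑ i, w i * L ((t + x - 1) ^ (N - i) * (t + x) ^ i)`,

the two polynomials satisfy `(x - 1) H* = x E - E^rev` and `(x - 1) F* = x² E - E^rev`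
(`X_sub_one_mul_dualChowPolynomial`, `dualAugChowPolynomial_eq`).

Both are shown to be interlaced by an explicit real-rooted polynomial. By partial fractions, it
suffices to know the signs at the roots of that polynomial
(`IsSimplyRealRooted.im_eq_zero_of_interlace`). As `(1 - x) (t + x) = t - x (t + x - 1)`, at a negative
number `x` the values `E` and `E^rev` are positive combinations of the refined Eulerian polynomials
`a j = L (t ^ (N - j) * (t + x - 1) ^ j)`, for `0 ≤ j ≤ N`. The first differences of the `a j` are the
corresponding polynomials of level `N - 1`, times `x - 1`, and `a N = x * a 0`. By induction on the
level, the sequence `a 0, …, a N` has a single sign change at every `x < 0`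
(`hasOneSignChange_refinedEulerian`), and it has none where `a 0 = A N` vanishes
(`exists_sign_refinedEulerian`). The latter gives the signs of `H*` at the roots of `A N`. The former,
as the ratios `C(i, l) / C(N, l)` decrease in `l`, gives opposite signs of `E` and `E^rev` at the
roots of the binomial Eulerian polynomial `L ((t + x) ^ N)` (`exists_sign_sum_choose`), hence the
signs of `F*` there.
-/

noncomputable section

namespace DualChow

open Polynomial Finset

/-! ### Interlacing via partial fractions -/

section Interlacing

/-- A monic real polynomial all of whose complex roots are real and simple. -/
structure IsSimplyRealRooted (f : ℝ[X]) : Prop where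
  monic : f.Monic
  im_eq_zero : ∀ z : ℂ, aeval z f = 0 → z.im = 0
  derivative_ne_zero : ∀ x, f.eval x = 0 → f.derivative.eval x ≠ 0

theorem IsSimplyRealRooted.eq_nodal {f : ℝ[X]} (hf : IsSimplyRealRooted f) :
    f = Lagrange.nodal f.roots.toFinset id := by
  have hs : f.Splits := by
    refine Splits.of_splits_map (algebraMap ℝ ℂ) (IsAlgClosed.splits _) fun z hz => ?_
    have h0 : aeval z f = 0 := by
      have := (mem_roots'.1 hz).2
      rwa [IsRoot.def, eval_map_algebraMap] at this
    exact ⟨z.re, Complex.ext (by simp) (by simp [hf.im_eq_zero z h0])⟩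
  have hn : f.roots.Nodup := by
    refine Multiset.nodup_iff_count_le_one.2 fun x => ?_
    rw [count_roots]
    by_contra! h
    have := (one_lt_rootMultiplicity_iff_isRoot hf.monic.ne_zero).1 h
    exact hf.derivative_ne_zero x this.1 this.2
  conv_lhs => rw [hs.eq_prod_roots_of_monic hf.monic]
  rw [Lagrange.nodal, Finset.prod_eq_multiset_prod, Multiset.toFinset_val, hn.dedup]
  rfl

/-- Partial fraction expansion of `g / f`, where `f` is monic with simple roots in `S` and
`deg g ≤ deg f + 1`. -/
theorem aeval_eq_aeval_nodal_mul (S : Finset ℝ) (g : ℝ[X]) (hg : g.natDegree ≤ #S + 1) :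
    ∃ b : ℝ, ∀ (K : Type) [Field K] [Algebra ℝ K] (z : K), aeval z (Lagrange.nodal S id) ≠ 0 →
      aeval z g = aeval z (Lagrange.nodal S id) *
        (algebraMap ℝ K (g.coeff (#S + 1)) * z + algebraMap ℝ K b
          + ∑ α ∈ S, algebraMap ℝ K (g.eval α * ((Lagrange.nodal S id).derivative.eval α)⁻¹)
            * (z - algebraMap ℝ K α)⁻¹) := by
  set f : ℝ[X] := Lagrange.nodal S id with hf
  have hfm : f.Monic := Lagrange.nodal_monic
  have hfd : f.natDegree = #S := Lagrange.natDegree_nodal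
  set a := g.coeff (#S + 1)
  set g₁ := g - C a * (X * f) with hg₁
  have hXf : (X * f).natDegree = #S + 1 := by rw [natDegree_X_mul hfm.ne_zero, hfd]
  have hc : (X * f).coeff (#S + 1) = 1 := by
    rw [coeff_X_mul, ← hfd]; exact hfm
  have hg₁d : g₁.natDegree ≤ #S := by
    have h1 : g₁.natDegree ≤ #S + 1 :=
      (natDegree_sub_le _ _).trans (max_le hg ((natDegree_C_mul_le _ _).trans hXf.le))
    refine natDegree_le_iff_coeff_eq_zero.2 fun N hN => ?_
    rcases (Nat.succ_le_of_lt hN).eq_or_lt with h | h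
    · rw [← h, hg₁, coeff_sub, coeff_C_mul]
      change a - a * (X * f).coeff (#S + 1) = 0
      rw [hc]; ring
    · exact coeff_eq_zero_of_natDegree_lt (h1.trans_lt h)
  set b := g₁.coeff (#S)
  set R := g₁ - C b * f with hR
  have hRd : R.degree < #S := by
    rw [degree_lt_iff_coeff_zero]
    intro N hN
    rcases hN.eq_or_lt with h | h
    · rw [← h, hR, coeff_sub, coeff_C_mul]
      have : f.coeff (#S) = 1 := by rw [← hfd]; exact hfm
      rw [this]; ring
    · rw [hR, coeff_sub, coeff_C_mul, coeff_eq_zero_of_natDegree_lt (hg₁d.trans_lt h),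
        coeff_eq_zero_of_natDegree_lt (hfd.le.trans_lt h)]; ring
  have hfS : ∀ α ∈ S, f.eval α = 0 := fun α hα => Lagrange.eval_nodal_at_node (v := id) hα
  have hRe : ∀ α ∈ S, R.eval α = g.eval α := fun α hα => by
    simp [hR, hg₁, hfS α hα]
  have hRi := Lagrange.eq_interpolate_of_eval_eq (v := id) (fun α => g.eval α)
    Function.injective_id.injOn hRd hRe
  refine ⟨b, fun K _ _ z hz => ?_⟩
  have hgR : g = C a * (X * f) + C b * f + R := by rw [hR, hg₁]; ring
  have hRz : aeval z R = aeval z f *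
      ∑ α ∈ S, algebraMap ℝ K (g.eval α * (f.derivative.eval α)⁻¹)
            * (z - algebraMap ℝ K α)⁻¹ := by
    rw [hRi, Lagrange.interpolate_apply, map_sum, mul_sum]
    refine sum_congr rfl fun α hα => ?_
    have hfα : f = (X - C α) * Lagrange.nodal (S.erase α) id := by
      rw [hf]; exact Lagrange.nodal_eq_mul_nodal_erase (v := id) hα
    have hfz : aeval z f = (z - algebraMap ℝ K α) * aeval z (Lagrange.nodal (S.erase α) id) := by
      conv_lhs => rw [hfα]
      simp
    have hne : z - algebraMap ℝ K α ≠ 0 := fun h => hz (by rw [hfz, h, zero_mul])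
    have hw : Lagrange.nodalWeight S id α = (f.derivative.eval α)⁻¹ :=
      Lagrange.nodalWeight_eq_eval_derivative_nodal (v := id) hα
    rw [Lagrange.basis_eq_prod_sub_inv_mul_nodal_div hα, ← Lagrange.nodal_erase_eq_nodal_div hα,
      hw, hfz]
    simp only [map_mul, aeval_C]
    field_simp
  conv_lhs => rw [hgR]
  simp only [map_add, map_mul, aeval_C, aeval_X, hRz]
  ring

variable {f g : ℝ[X]}

/-- If `g` has positive leading coefficient and degree `deg f + 1`, and if its signs at the roots of
`f` are those of a polynomial interlaced by `f`, then `g` is real-rooted: the imaginary part of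
`g / f` has the sign of the imaginary part of its argument. -/
theorem IsSimplyRealRooted.im_eq_zero_of_interlace (hf : IsSimplyRealRooted f)
    (hd : g.natDegree = f.natDegree + 1) (hg : 0 < g.leadingCoeff)
    (h : ∀ α, f.eval α = 0 → f.derivative.eval α * g.eval α ≤ 0)
    (z : ℂ) (hz : aeval z g = 0) : z.im = 0 := by
  by_contra him
  set S := f.roots.toFinset
  have hfS : f = Lagrange.nodal S id := hf.eq_nodal
  have hcard : #S = f.natDegree := by
    conv_rhs => rw [hfS]
    exact Lagrange.natDegree_nodal.symm
  obtain ⟨b, hb⟩ := aeval_eq_aeval_nodal_mul S g (by omega)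
  have hfz : aeval z f ≠ 0 := fun h0 => him (hf.im_eq_zero z h0)
  have key := hb ℂ z (by rwa [← hfS])
  rw [← hfS, hz, zero_eq_mul, or_iff_right hfz, hcard, ← hd] at key
  have key2 := congrArg Complex.im key
  simp only [Complex.coe_algebraMap, Complex.add_im, Complex.im_sum, Complex.im_ofReal_mul,
    Complex.inv_im, Complex.sub_im, Complex.ofReal_im, sub_zero, Complex.zero_im, add_zero] at key2
  have hnn : 0 ≤ ∑ α ∈ S, -(g.eval α * (f.derivative.eval α)⁻¹) / Complex.normSq (z - α) := by
    refine sum_nonneg fun α hα => div_nonneg ?_ (Complex.normSq_nonneg _)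
    have hα0 : f.eval α = 0 := (mem_roots'.1 (Multiset.mem_toFinset.1 hα)).2
    have h1 := h α hα0
    have h2 := hf.derivative_ne_zero α hα0
    have : g.eval α * (f.derivative.eval α)⁻¹
        = (f.derivative.eval α * g.eval α) / (f.derivative.eval α) ^ 2 := by
      field_simp
    rw [this, Left.nonneg_neg_iff]
    exact div_nonpos_of_nonpos_of_nonneg h1 (sq_nonneg _)
  have hfac : z.im * (g.leadingCoeff
      + ∑ α ∈ S, -(g.eval α * (f.derivative.eval α)⁻¹) / Complex.normSq (z - α)) = 0 := by
    rw [mul_add, mul_sum]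
    refine Eq.trans (congrArg₂ (· + ·) (mul_comm _ _) (sum_congr rfl fun α _ => ?_)) key2
    ring
  rcases mul_eq_zero.1 hfac with h | h
  · exact him h
  · linarith

/-- Under strict sign conditions at the roots of `f`, the quotient `g / f` is strictly increasing
between them, so that `g` has the sign of `-f` just before each of its roots. -/
theorem IsSimplyRealRooted.eval_mul_derivative_pos (hf : IsSimplyRealRooted f)
    (hd : g.natDegree = f.natDegree + 1) (hg : 0 < g.leadingCoeff)
    (h : ∀ α, f.eval α = 0 → f.derivative.eval α * g.eval α < 0)
    (β : ℝ) (hβ : g.eval β = 0) : 0 < f.eval β * g.derivative.eval β := by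
  set S := f.roots.toFinset
  have hfS : f = Lagrange.nodal S id := hf.eq_nodal
  have hcard : #S = f.natDegree := by
    conv_rhs => rw [hfS]
    exact Lagrange.natDegree_nodal.symm
  have hfβ : f.eval β ≠ 0 := fun h0 => by
    have := h β h0
    rw [hβ, mul_zero] at this
    exact lt_irrefl _ this
  obtain ⟨b, hb⟩ := aeval_eq_aeval_nodal_mul S g (by omega)
  set c : ℝ → ℝ := fun α => g.eval α * (f.derivative.eval α)⁻¹
  set φ : ℝ → ℝ := fun x => g.leadingCoeff * x + b + ∑ α ∈ S, c α * (x - α)⁻¹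
  have hgφ : ∀ x, f.eval x ≠ 0 → g.eval x = f.eval x * φ x := fun x hx => by
    have := hb ℝ x (by rw [← hfS, coe_aeval_eq_eval]; exact hx)
    rw [← hfS, hcard, ← hd] at this
    simpa using this
  have hSβ : ∀ α ∈ S, β - α ≠ 0 := fun α hα h0 => by
    have hα0 : f.eval α = 0 := (mem_roots'.1 (Multiset.mem_toFinset.1 hα)).2
    rw [sub_eq_zero] at h0
    exact hfβ (h0 ▸ hα0)
  have hφ' : HasDerivAt φ (g.leadingCoeff + ∑ α ∈ S, c α * (-1 / (β - α) ^ 2)) β := by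
    have h1 : HasDerivAt (fun x => ∑ α ∈ S, c α * (x - α)⁻¹)
        (∑ α ∈ S, c α * (-1 / (β - α) ^ 2)) β :=
      HasDerivAt.fun_sum fun α hα =>
        (((hasDerivAt_id β).sub_const α).inv (hSβ α hα)).const_mul (c α)
    have h2 : HasDerivAt (fun x => g.leadingCoeff * x + b) g.leadingCoeff β := by
      simpa using ((hasDerivAt_id β).const_mul g.leadingCoeff).add_const b
    exact h2.add h1
  have hφβ : φ β = 0 := by
    have := hgφ β hfβ
    rw [hβ, zero_eq_mul] at this
    exact this.resolve_left hfβ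
  have hev : (fun x => g.eval x) =ᶠ[nhds β] fun x => f.eval x * φ x := by
    filter_upwards [f.continuous.continuousAt.eventually_ne hfβ] with x hx using hgφ x hx
  have hD := ((f.hasDerivAt β).mul hφ').congr_of_eventuallyEq hev
  rw [(g.hasDerivAt β).unique hD, hφβ, mul_zero, zero_add, ← mul_assoc]
  refine mul_pos (mul_self_pos.2 hfβ) (add_pos_of_pos_of_nonneg hg (sum_nonneg fun α hα => ?_))
  have hα0 : f.eval α = 0 := (mem_roots'.1 (Multiset.mem_toFinset.1 hα)).2
  have h1 := h α hα0
  have h2 := hf.derivative_ne_zero α hα0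
  have h3 := hSβ α hα
  have : c α * (-1 / (β - α) ^ 2)
      = -(f.derivative.eval α * g.eval α) / ((f.derivative.eval α) ^ 2 * (β - α) ^ 2) := by
    simp only [c]
    field_simp
  rw [this]
  exact div_nonneg (by linarith) (by positivity)

/-- A monic polynomial strictly interlaced by a simply real-rooted one is simply real-rooted. -/
theorem IsSimplyRealRooted.of_interlace (hf : IsSimplyRealRooted f) (hm : g.Monic)
    (hd : g.natDegree = f.natDegree + 1)
    (h : ∀ α, f.eval α = 0 → f.derivative.eval α * g.eval α < 0) : IsSimplyRealRooted g where
  monic := hm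
  im_eq_zero := hf.im_eq_zero_of_interlace hd (by simp [hm.leadingCoeff]) fun α hα => (h α hα).le
  derivative_ne_zero β hβ h0 := by
    have := hf.eval_mul_derivative_pos hd (by simp [hm.leadingCoeff]) h β hβ
    rw [h0, mul_zero] at this
    exact lt_irrefl _ this

theorem isSimplyRealRooted_one : IsSimplyRealRooted 1 where
  monic := monic_one
  im_eq_zero z h := by simp at h
  derivative_ne_zero x h := by simp at h

end Interlacing

/-! ### Eulerian polynomials and their umbral functional -/

section Eulerian

variable {R S : Type*} [CommRing R] [CommRing S]

/-- The value at `x` of the `n`-th Eulerian polynomial, normalised as `1, 1, 1 + x, 1 + 4x + x², …`.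
The point `x` lies in an arbitrary commutative ring, so that `eulerian X n` is the polynomial
itself. -/
def eulerian (x : R) : ℕ → R
  | 0 => 1
  | n + 1 => ∑ k : Fin (n + 1), ((n + 1).choose k : R) * (x - 1) ^ (n - k) * eulerian x k

@[simp] theorem eulerian_zero (x : R) : eulerian x 0 = 1 := by rw [eulerian]

theorem eulerian_succ (x : R) (n : ℕ) : eulerian x (n + 1) =
    ∑ k ∈ range (n + 1), ((n + 1).choose k : R) * (x - 1) ^ (n - k) * eulerian x k := by
  rw [eulerian, Finset.sum_range]

@[simp] theorem eulerian_one (x : R) : eulerian x 1 = 1 := by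
  simp [eulerian_succ]

theorem map_eulerian (φ : R →+* S) (x : R) (n : ℕ) : φ (eulerian x n) = eulerian (φ x) n := by
  induction n using Nat.strong_induction_on with
  | _ n ih =>
    cases n with
    | zero => simp
    | succ n =>
      rw [eulerian_succ, eulerian_succ, map_sum]
      refine sum_congr rfl fun k hk => ?_
      simp [ih k (mem_range.1 hk)]

/-- The linear functional on `R[t]` that sends `t ^ k` to the `k`-th Eulerian polynomial at `x`. -/
def umbral (x : R) : R[X] →ₗ[R] R :=
  Polynomial.lsum fun k => LinearMap.toSpanSingleton R R (eulerian x k)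

theorem umbral_monomial (x c : R) (k : ℕ) : umbral x (monomial k c) = c * eulerian x k := by
  simp [umbral, Polynomial.lsum_apply, sum_monomial_index]

@[simp] theorem umbral_X_pow (x : R) (k : ℕ) : umbral x (X ^ k) = eulerian x k := by
  rw [X_pow_eq_monomial, umbral_monomial, one_mul]

theorem umbral_C_mul (x c : R) (p : R[X]) : umbral x (C c * p) = c * umbral x p := by
  rw [C_mul', map_smul, smul_eq_mul]

theorem umbral_shift_pow (x : R) (k : ℕ) :
    umbral x ((X + C (x - 1)) ^ (k + 1)) = x * eulerian x (k + 1) := by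
  rw [add_pow, map_sum, sum_range_succ]
  simp only [Nat.choose_self, tsub_self, pow_zero, mul_one, Nat.cast_one, umbral_X_pow]
  have : ∑ l ∈ range (k + 1), umbral x (X ^ l * C (x - 1) ^ (k + 1 - l) * ((k + 1).choose l : R[X]))
      = (x - 1) * eulerian x (k + 1) := by
    rw [eulerian_succ, mul_sum]
    refine sum_congr rfl fun l hl => ?_
    have hl' : k + 1 - l = (k - l) + 1 := by have := mem_range.1 hl; omega
    have : (X ^ l * C (x - 1) ^ (k + 1 - l) * ((k + 1).choose l : R[X]))
        = C ((x - 1) ^ (k + 1 - l) * ((k + 1).choose l : R)) * X ^ l := by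
      simp only [map_mul, map_pow, map_natCast]; ring
    rw [this, umbral_C_mul, umbral_X_pow, hl', pow_succ]
    ring
  rw [this]; ring

/-- The functional equation that characterises the Eulerian polynomials: it says that
`e^{(x-1)z} A(z) = x A(z) - (x - 1)` for their exponential generating function `A`. -/
theorem umbral_comp_shift (x : R) (p : R[X]) :
    umbral x (p.comp (X + C (x - 1))) = x * umbral x p - (x - 1) * p.eval 0 := by
  induction p using Polynomial.induction_on' with
  | add p q hp hq => simp only [add_comp, map_add, hp, hq, eval_add]; ring
  | monomial k c =>
    rw [monomial_comp, umbral_C_mul, umbral_monomial]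
    cases k with
    | zero =>
      have : umbral x 1 = 1 := by simpa using umbral_X_pow x 0
      simp [this]; ring
    | succ k => rw [umbral_shift_pow]; simp; ring

/-- The recurrence satisfied by the Chow polynomials of Boolean lattices. -/
theorem sum_choose_mul_eulerian (x : R) (s : ℕ) :
    ∑ k ∈ range (s + 1), (s.choose k : R) * eulerian x k * (x ^ (s - k) - x) = -(x - 1) := by
  have h := umbral_comp_shift x ((X + 1) ^ s)
  have h1 : ∀ y : R, umbral x ((X + C y) ^ s)
      = ∑ k ∈ range (s + 1), (s.choose k : R) * eulerian x k * y ^ (s - k) := by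
    intro y
    rw [add_pow, map_sum]
    refine sum_congr rfl fun l _ => ?_
    have : (X ^ l * C y ^ (s - l) * (s.choose l : R[X]))
        = C (y ^ (s - l) * (s.choose l : R)) * X ^ l := by
      simp only [map_mul, map_pow, map_natCast]; ring
    rw [this, umbral_C_mul, umbral_X_pow]
    ring
  have e1 : ((X + 1) ^ s).comp (X + C (x - 1)) = (X + C x) ^ s := by
    simp only [pow_comp, add_comp, X_comp, one_comp, map_sub, map_one]; ring
  have e2 : ((X : R[X]) + 1) ^ s = (X + C 1) ^ s := by simp
  rw [e1, e2, h1, h1] at h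
  simp only [one_pow, mul_one, map_one, eval_pow, eval_add, eval_X, eval_one, zero_add] at h
  simp only [mul_sub, sum_sub_distrib, h, ← sum_mul]
  ring

end Eulerian

/-! ### Refined Eulerian polynomials at a negative point -/

section Refined

section Ring

variable {R : Type*} [CommRing R]

/-- The value at `x` of the `j`-th refined Eulerian polynomial of level `N`, for `j ≤ N`. These
polynomials interpolate, for `N ≥ 1`, between the Eulerian polynomial `A N` at `j = 0` and `x * A N`
at `j = N`, and their sum over `j` is `A (N + 1)`. -/
def refinedEulerian (x : R) (N j : ℕ) : R := umbral x (X ^ (N - j) * (X + C (x - 1)) ^ j)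

@[simp] theorem refinedEulerian_zero_right (x : R) (N : ℕ) :
    refinedEulerian x N 0 = eulerian x N := by
  simp [refinedEulerian]

theorem refinedEulerian_self (x : R) (N : ℕ) :
    refinedEulerian x (N + 1) (N + 1) = x * eulerian x (N + 1) := by
  simp only [refinedEulerian, tsub_self, pow_zero, one_mul]
  exact umbral_shift_pow x N

theorem refinedEulerian_succ_succ (x : R) {N j : ℕ} (h : j ≤ N) :
    refinedEulerian x (N + 1) (j + 1)
      = refinedEulerian x (N + 1) j + (x - 1) * refinedEulerian x N j := by
  simp only [refinedEulerian]
  rw [← umbral_C_mul, ← map_add, Nat.succ_sub_succ, Nat.succ_sub h, pow_succ,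
    pow_succ]
  congr 1
  ring

theorem refinedEulerian_eq_add_sum (x : R) {N j : ℕ} (h : j ≤ N + 1) :
    refinedEulerian x (N + 1) j
      = eulerian x (N + 1) + (x - 1) * ∑ l ∈ range j, refinedEulerian x N l := by
  induction j with
  | zero => simp
  | succ j ih =>
    rw [refinedEulerian_succ_succ x (by omega), ih (by omega), sum_range_succ]
    ring

theorem sub_one_mul_eulerian_succ (x : R) (N : ℕ) :
    (x - 1) * eulerian x (N + 1) = (x - 1) * ∑ l ∈ range (N + 1), refinedEulerian x N l := by
  have h := refinedEulerian_eq_add_sum x (le_refl (N + 1))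
  rw [refinedEulerian_self] at h
  linear_combination h

/-- Since `(1 - x) (t + x) = t - x (t + x - 1)`, powers of `t + x` expand positively in the refined
Eulerian polynomials at negative points. -/
theorem one_sub_pow_mul_umbral (x : R) (k l i : ℕ) :
    (1 - x) ^ i * umbral x (X ^ k * (X + C (x - 1)) ^ l * (X + C x) ^ i)
      = ∑ j ∈ range (i + 1), (i.choose j : R) * (-x) ^ j
        * refinedEulerian x (k + l + i) (l + j) := by
  have h : C ((1 - x) ^ i) * (X + C x) ^ i = (C (-x) * (X + C (x - 1)) + X) ^ i := by
    rw [map_pow, ← mul_pow]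
    congr 1
    simp only [map_sub, map_neg, map_one]
    ring
  rw [← umbral_C_mul]
  have h2 : C ((1 - x) ^ i) * (X ^ k * (X + C (x - 1)) ^ l * (X + C x) ^ i)
      = X ^ k * (X + C (x - 1)) ^ l * (C (-x) * (X + C (x - 1)) + X) ^ i := by
    rw [← h]; ring
  rw [h2, add_pow (C (-x) * (X + C (x - 1))), mul_sum, map_sum]
  refine sum_congr rfl fun j hj => ?_
  have hj' : k + l + i - (l + j) = k + (i - j) := by have := mem_range.1 hj; omega
  rw [refinedEulerian, hj', ← umbral_C_mul]
  congr 1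
  simp only [map_mul, map_pow, map_natCast, pow_add, mul_pow]
  ring

theorem one_sub_pow_mul_umbral_left (x : R) {N i : ℕ} (hi : i ≤ N) :
    (1 - x) ^ i * umbral x (X ^ (N - i) * (X + C x) ^ i)
      = ∑ l ∈ range (N + 1), (i.choose l : R) * (-x) ^ l * refinedEulerian x N l := by
  have h := one_sub_pow_mul_umbral x (N - i) 0 i
  simp only [pow_zero, mul_one, add_zero, zero_add, Nat.sub_add_cancel hi] at h
  rw [h]
  refine sum_subset (range_subset_range.2 (by omega)) fun l _ hl => ?_
  rw [mem_range, not_lt] at hl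
  rw [Nat.choose_eq_zero_of_lt (by omega)]
  simp

theorem one_sub_pow_mul_umbral_right (x : R) {N i : ℕ} (hi : i ≤ N) :
    (1 - x) ^ i * ((-x) ^ (N - i) * umbral x ((X + C (x - 1)) ^ (N - i) * (X + C x) ^ i))
      = ∑ l ∈ range (N + 1), (i.choose (N - l) : R) * (-x) ^ l * refinedEulerian x N l := by
  have h := one_sub_pow_mul_umbral x 0 (N - i) i
  simp only [pow_zero, one_mul, zero_add, Nat.sub_add_cancel hi] at h
  rw [mul_left_comm, h]
  have hs : ∑ l ∈ range (N + 1), (i.choose (N - l) : R) * (-x) ^ l * refinedEulerian x N l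
      = ∑ l ∈ Ico (N - i) (N + 1), (i.choose (N - l) : R) * (-x) ^ l * refinedEulerian x N l := by
    symm
    refine sum_subset (fun l hl => mem_range.2 (mem_Ico.1 hl).2) fun l hl hl' => ?_
    rw [mem_range] at hl
    rw [mem_Ico, not_and_or] at hl'
    rw [Nat.choose_eq_zero_of_lt (by omega)]
    simp
  have hN : N + 1 - (N - i) = i + 1 := by omega
  rw [hs, sum_Ico_eq_sum_range, hN, mul_sum]
  refine sum_congr rfl fun j hj => ?_
  have hj' : j ≤ i := by have := mem_range.1 hj; omega
  have : N - (N - i + j) = i - j := by omega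
  rw [this, Nat.choose_symm hj', pow_add]
  ring

end Ring

theorem eulerian_pos_and_refinedEulerian_nonneg {x : ℝ} (hx : 0 ≤ x) (N : ℕ) :
    0 < eulerian x N ∧ ∀ j ≤ N, 0 ≤ refinedEulerian x N j := by
  induction N with
  | zero =>
    refine ⟨by simp, fun j hj => ?_⟩
    obtain rfl : j = 0 := by omega
    simp
  | succ N ih =>
    have hsum : 0 < ∑ l ∈ range (N + 1), refinedEulerian x N l :=
      sum_pos' (fun l hl => ih.2 l (by have := mem_range.1 hl; omega))
        ⟨0, by simp, by simpa using ih.1⟩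
    rcases eq_or_ne x 1 with rfl | h1
    · have hA : 0 < eulerian (1 : ℝ) (N + 1) := by
        rw [eulerian_succ, sum_range_succ, sum_eq_zero fun k hk => ?_]
        · simpa using mul_pos (by positivity : (0 : ℝ) < N + 1) ih.1
        · have : N - k ≠ 0 := by have := mem_range.1 hk; omega
          simp [this]
      refine ⟨hA, fun j hj => ?_⟩
      rw [refinedEulerian_eq_add_sum _ hj]
      simpa using hA.le
    · have hA := mul_left_cancel₀ (sub_ne_zero.2 h1) (sub_one_mul_eulerian_succ x N)
      refine ⟨hA ▸ hsum, fun j hj => ?_⟩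
      rw [refinedEulerian_eq_add_sum _ hj, hA, ← sum_range_add_sum_Ico _ hj]
      have h2 : 0 ≤ ∑ l ∈ range j, refinedEulerian x N l :=
        sum_nonneg fun l hl => ih.2 l (by have := mem_range.1 hl; omega)
      have h3 : 0 ≤ ∑ l ∈ Ico j (N + 1), refinedEulerian x N l :=
        sum_nonneg fun l hl => ih.2 l (by have := mem_Ico.1 hl; omega)
      nlinarith [mul_nonneg hx h2]

theorem eulerian_pos {x : ℝ} (hx : 0 ≤ x) (N : ℕ) : 0 < eulerian x N :=
  (eulerian_pos_and_refinedEulerian_nonneg hx N).1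

theorem exists_refinedEulerian_ne_zero {x : ℝ} (hx : x < 0) (N : ℕ) :
    ∃ j ≤ N, refinedEulerian x N j ≠ 0 := by
  induction N with
  | zero => exact ⟨0, le_rfl, by simp⟩
  | succ N ih =>
    by_contra! h
    obtain ⟨j, hj, hj0⟩ := ih
    have := refinedEulerian_succ_succ x hj
    rw [h _ (by omega), h _ (by omega), zero_add, zero_eq_mul] at this
    exact this.elim (fun h => by linarith) hj0

/-- The terms `a 0, …, a N` change sign at most once. -/
def HasOneSignChange (a : ℕ → ℝ) (N : ℕ) : Prop :=
  ∃ ε : ℝ, (ε = 1 ∨ ε = -1) ∧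
    ∃ m, (∀ j < m, j ≤ N → 0 ≤ ε * a j) ∧ ∀ j, m ≤ j → j ≤ N → ε * a j ≤ 0

/-- By the difference equation `refinedEulerian_succ_succ`, a single sign change at level `N` makes
the next level a valley, up to sign. -/
theorem HasOneSignChange.exists_valley {x : ℝ} (hx : x < 0) {N : ℕ}
    (h : HasOneSignChange (refinedEulerian x N) N) :
    ∃ ε : ℝ, (ε = 1 ∨ ε = -1) ∧ ∃ m,
      (∀ i j, i ≤ j → j ≤ m → j ≤ N + 1 →
        ε * refinedEulerian x (N + 1) j ≤ ε * refinedEulerian x (N + 1) i) ∧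
      ∀ i j, m ≤ i → i ≤ j → j ≤ N + 1 →
        ε * refinedEulerian x (N + 1) i ≤ ε * refinedEulerian x (N + 1) j := by
  obtain ⟨ε, hε, m, h1, h2⟩ := h
  refine ⟨ε, hε, m, fun i j hij => ?_, fun i j hmi hij => ?_⟩
  · induction j, hij using Nat.le_induction with
    | base => exact fun _ _ => le_rfl
    | succ j hij ih =>
      intro hjm hjN
      refine le_trans ?_ (ih (by omega) (by omega))
      rw [refinedEulerian_succ_succ x (by omega)]
      have := h1 j (by omega) (by omega)
      nlinarith
  · induction j, hij using Nat.le_induction with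
    | base => exact fun _ => le_rfl
    | succ j hij ih =>
      intro hjN
      refine (ih (by omega)).trans ?_
      rw [refinedEulerian_succ_succ x (by omega)]
      have := h2 j (by omega) (by omega)
      nlinarith

theorem hasOneSignChange_refinedEulerian {x : ℝ} (hx : x < 0) (N : ℕ) :
    HasOneSignChange (refinedEulerian x N) N := by
  induction N with
  | zero =>
    refine ⟨1, Or.inl rfl, 1, fun j hj _ => ?_, fun j hj hj' => by omega⟩
    obtain rfl : j = 0 := by omega
    simp
  | succ N ih =>
    obtain ⟨ε, hε, m, hdec, hinc⟩ := ih.exists_valley hx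
    set d := fun j => ε * refinedEulerian x (N + 1) j with hd
    have hend : d (N + 1) = x * d 0 := by
      simp only [hd, refinedEulerian_self, refinedEulerian_zero_right]; ring
    rcases le_or_gt 0 (d 0) with h0 | h0
    · have hend' : d (N + 1) ≤ 0 := hend ▸ mul_nonpos_of_nonpos_of_nonneg hx.le h0
      by_cases hex : ∃ j, j ≤ N + 1 ∧ d j < 0
      · classical
        refine ⟨ε, hε, Nat.find hex, fun j hj hjN => ?_, fun j hj hjN => ?_⟩
        · have := Nat.find_min hex hj
          push Not at this
          exact this hjN
        · rcases le_or_gt j m with hjm | hjm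
          · exact (hdec _ j hj hjm hjN).trans (Nat.find_spec hex).2.le
          · exact (hinc j (N + 1) hjm.le hjN le_rfl).trans hend'
      · push Not at hex
        exact ⟨ε, hε, N + 2, fun j _ hj => hex j hj, fun j hj hj' => by omega⟩
    · have hend' : 0 < d (N + 1) := hend ▸ mul_pos_of_neg_of_neg hx h0
      have hex : ∃ j, j ≤ N + 1 ∧ 0 < d j := ⟨N + 1, le_rfl, hend'⟩
      classical
      refine ⟨-ε, by rcases hε with rfl | rfl <;> simp, Nat.find hex, fun j hj hjN => ?_,
        fun j hj hjN => ?_⟩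
      · have := Nat.find_min hex hj
        push Not at this
        have h3 : ε * refinedEulerian x (N + 1) j ≤ 0 := this hjN
        linarith
      · have hspec := Nat.find_spec hex
        have hm : m ≤ Nat.find hex := by
          by_contra! hlt
          have := hdec 0 _ (Nat.zero_le _) hlt.le hspec.1
          exact absurd (hspec.2.trans_le this) (not_lt.2 h0.le)
        have h3 : 0 < ε * refinedEulerian x (N + 1) j := hspec.2.trans_le (hinc _ j hm hj hjN)
        linarith

/-- At a root of `A (N + 1)`, the valley of refined Eulerian polynomials starts and ends at zero. -/
theorem exists_sign_refinedEulerian {x : ℝ} (hx : x < 0) {N : ℕ} (h0 : eulerian x (N + 1) = 0) :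
    ∃ ε : ℝ, (ε = 1 ∨ ε = -1) ∧ ∀ j ≤ N + 1, ε * refinedEulerian x (N + 1) j ≤ 0 := by
  obtain ⟨ε, hε, m, hdec, hinc⟩ := (hasOneSignChange_refinedEulerian hx N).exists_valley hx
  refine ⟨ε, hε, fun j hj => ?_⟩
  rcases le_or_gt j m with hjm | hjm
  · simpa [h0] using hdec 0 j (Nat.zero_le _) hjm hj
  · simpa [h0, refinedEulerian_self] using hinc j (N + 1) hjm.le hj le_rfl

end Refined

/-! ### The Eulerian polynomials interlace -/

section EulerianInterlacing

theorem map_umbral {R S : Type*} [CommRing R] [CommRing S] (φ : R →+* S) (x : R) (p : R[X]) :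
    φ (umbral x p) = umbral (φ x) (p.map φ) := by
  induction p using Polynomial.induction_on' with
  | add p q hp hq => simp only [map_add, Polynomial.map_add, hp, hq]
  | monomial k c => simp only [umbral_monomial, map_monomial, map_mul, map_eulerian]

@[simp] theorem eval_eulerian (x : ℝ) (n : ℕ) : (eulerian (X : ℝ[X]) n).eval x = eulerian x n := by
  simpa using map_eulerian (evalRingHom x) X n

theorem natDegree_natCast_mul_le (c : ℕ) (p : ℝ[X]) : ((c : ℝ[X]) * p).natDegree ≤ p.natDegree := by
  simpa using natDegree_mul_le (p := (c : ℝ[X])) (q := p)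

theorem natDegree_eulerian_le (n : ℕ) : (eulerian (X : ℝ[X]) n).natDegree ≤ n - 1 := by
  induction n using Nat.strong_induction_on with
  | _ n ih =>
    cases n with
    | zero => simp
    | succ n =>
      rw [eulerian_succ]
      refine natDegree_sum_le_of_forall_le _ _ fun k hk => ?_
      have hk' := mem_range.1 hk
      refine natDegree_mul_le_of_le (m := n - k) (n := k - 1) ?_ (ih k hk') |>.trans (by omega)
      refine (natDegree_natCast_mul_le _ _).trans ?_
      exact (natDegree_pow_le_of_le _ (natDegree_X_sub_C_le 1)).trans (by omega)

theorem coeff_eulerian_succ (n : ℕ) : (eulerian (X : ℝ[X]) (n + 1)).coeff n = 1 := by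
  rw [eulerian_succ, sum_range_succ', coeff_add, finsetSum_coeff, sum_eq_zero fun k hk => ?_]
  · have h : ((X : ℝ[X]) - 1) ^ n = (X - C 1) ^ n := by simp
    have hm : ((X : ℝ[X]) - C 1) ^ n |>.Monic := (monic_X_sub_C 1).pow n
    have hd : (((X : ℝ[X]) - C 1) ^ n).natDegree = n := by
      rw [(monic_X_sub_C 1).natDegree_pow, natDegree_X_sub_C, mul_one]
    have := hm.coeff_natDegree
    rw [hd] at this
    simp [h, this]
  · have hk' := mem_range.1 hk
    refine coeff_eq_zero_of_natDegree_lt (lt_of_le_of_lt (b := n - 1) ?_ (by omega))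
    refine natDegree_mul_le_of_le (m := n - (k + 1)) (n := k) ?_
      (natDegree_eulerian_le (k + 1)) |>.trans (by omega)
    refine (natDegree_natCast_mul_le _ _).trans ?_
    exact (natDegree_pow_le_of_le _ (natDegree_X_sub_C_le 1)).trans (by omega)

theorem monic_eulerian_succ (n : ℕ) : (eulerian (X : ℝ[X]) (n + 1)).Monic :=
  monic_of_natDegree_le_of_coeff_eq_one n (natDegree_eulerian_le _) (coeff_eulerian_succ n)

theorem natDegree_eulerian_succ (n : ℕ) : (eulerian (X : ℝ[X]) (n + 1)).natDegree = n :=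
  natDegree_eq_of_le_of_coeff_ne_zero (natDegree_eulerian_le _)
    (by rw [coeff_eulerian_succ]; exact one_ne_zero)

theorem neg_of_eulerian_eq_zero {x : ℝ} {n : ℕ} (h : eulerian x n = 0) : x < 0 := by
  by_contra! hx
  exact (eulerian_pos hx n).ne' h

/-- At a root of `A (n + 1)`, all refined Eulerian polynomials of that level have the sign opposite
to `A n`, or vanish. -/
theorem eulerian_mul_refinedEulerian_nonpos {x : ℝ} {n : ℕ} (h : eulerian x (n + 1) = 0)
    {j : ℕ} (hj : j ≤ n + 1) (hn : eulerian x n ≠ 0) :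
    eulerian x n * refinedEulerian x (n + 1) j ≤ 0 := by
  have hx := neg_of_eulerian_eq_zero h
  obtain ⟨ε, hε, hs⟩ := exists_sign_refinedEulerian hx h
  have h1 := hs 1 (by omega)
  have hstep := refinedEulerian_succ_succ x (Nat.zero_le n)
  rw [zero_add, refinedEulerian_zero_right, refinedEulerian_zero_right, h, zero_add] at hstep
  rw [hstep] at h1
  have h2 : 0 < ε * eulerian x n := by
    refine lt_of_le_of_ne ?_ (mul_ne_zero (by rcases hε with rfl | rfl <;> simp) hn).symm
    nlinarith
  have h3 := hs j hj
  have h4 : ε * ε = 1 := by rcases hε with rfl | rfl <;> norm_num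
  calc eulerian x n * refinedEulerian x (n + 1) j
      = (ε * eulerian x n) * (ε * refinedEulerian x (n + 1) j) := by
        linear_combination (-(eulerian x n * refinedEulerian x (n + 1) j)) * h4
    _ ≤ 0 := mul_nonpos_of_nonneg_of_nonpos h2.le h3

/-- A combination of refined Eulerian polynomials with positive coefficients has, at a root of
`A (n + 1)`, the sign opposite to `A n`. -/
theorem eulerian_mul_sum_neg {x : ℝ} {n : ℕ} (h : eulerian x (n + 1) = 0)
    (hn : eulerian x n ≠ 0) {w : ℕ → ℝ} (hw : ∀ j ≤ n + 1, 0 < w j) :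
    eulerian x n * ∑ j ∈ range (n + 2), w j * refinedEulerian x (n + 1) j < 0 := by
  have hx := neg_of_eulerian_eq_zero h
  obtain ⟨j, hj, hj0⟩ := exists_refinedEulerian_ne_zero hx (n + 1)
  have hle : ∀ i ≤ n + 1, eulerian x n * (w i * refinedEulerian x (n + 1) i) ≤ 0 := fun i hi => by
    rw [mul_left_comm]
    exact mul_nonpos_of_nonneg_of_nonpos (hw i hi).le (eulerian_mul_refinedEulerian_nonpos h hi hn)
  rw [mul_sum]
  refine sum_neg' (fun i hi => hle i (by have := mem_range.1 hi; omega)) ⟨j, by simp; omega, ?_⟩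
  exact lt_of_le_of_ne (hle j hj) (mul_ne_zero hn (mul_ne_zero (hw j hj).ne' hj0))

/-- The Eulerian polynomials are simply real-rooted, and consecutive ones interlace strictly. -/
theorem isSimplyRealRooted_eulerian_and_pos (n : ℕ) :
    IsSimplyRealRooted (eulerian (X : ℝ[X]) (n + 1)) ∧
      ∀ α, eulerian α (n + 1) = 0 →
        0 < eulerian α n * (eulerian (X : ℝ[X]) (n + 1)).derivative.eval α := by
  induction n with
  | zero =>
    refine ⟨?_, fun α h => ?_⟩
    · rw [zero_add, eulerian_one]; exact isSimplyRealRooted_one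
    · simp at h
  | succ n ih =>
    have hd : (eulerian (X : ℝ[X]) (n + 1 + 1)).natDegree
        = (eulerian (X : ℝ[X]) (n + 1)).natDegree + 1 := by
      rw [natDegree_eulerian_succ, natDegree_eulerian_succ]
    have hlt : ∀ α, (eulerian (X : ℝ[X]) (n + 1)).eval α = 0 →
        (eulerian (X : ℝ[X]) (n + 1)).derivative.eval α
          * (eulerian (X : ℝ[X]) (n + 1 + 1)).eval α < 0 := by
      intro α hα
      rw [eval_eulerian] at hα ⊢
      have hx := neg_of_eulerian_eq_zero hα
      have hp := ih.2 α hα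
      have hn : eulerian α n ≠ 0 := left_ne_zero_of_mul hp.ne'
      have hA := mul_left_cancel₀ (sub_ne_zero.2 (by linarith : α ≠ 1))
        (sub_one_mul_eulerian_succ α (n + 1))
      have hs := eulerian_mul_sum_neg hα hn (w := fun _ => 1) fun _ _ => one_pos
      simp only [one_mul] at hs
      rw [← hA] at hs
      by_contra! hc
      nlinarith [mul_pos hp (neg_pos.2 hs), sq_nonneg (eulerian α n)]
    refine ⟨ih.1.of_interlace (monic_eulerian_succ _) hd hlt, fun α hα => ?_⟩
    have := ih.1.eval_mul_derivative_pos hd (by simp [(monic_eulerian_succ (n + 1)).leadingCoeff])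
      hlt α (by rwa [eval_eulerian])
    rwa [eval_eulerian] at this

/-- At a root `x` of `A (n + 1)`, the refined Eulerian polynomials have the sign opposite to the
derivative of `A (n + 1)`, or vanish. -/
theorem derivative_eulerian_mul_nonpos {x : ℝ} {n : ℕ} (h : eulerian x (n + 1) = 0)
    {j : ℕ} (hj : j ≤ n + 1) :
    (eulerian (X : ℝ[X]) (n + 1)).derivative.eval x * refinedEulerian x (n + 1) j ≤ 0 := by
  have hp := (isSimplyRealRooted_eulerian_and_pos n).2 x h
  have h1 := eulerian_mul_refinedEulerian_nonpos h hj (left_ne_zero_of_mul hp.ne')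
  by_contra! hc
  nlinarith [mul_pos hp hc, sq_nonneg ((eulerian (X : ℝ[X]) (n + 1)).derivative.eval x)]

end EulerianInterlacing

/-! ### Binomial Eulerian polynomials -/

section Binomial

/-- The value at `x` of the `n`-th binomial Eulerian polynomial `∑ p, C(n, p) x ^ p A (n - p)`. -/
def binomialEulerian {R : Type*} [CommRing R] (x : R) (n : ℕ) : R := umbral x ((X + C x) ^ n)

theorem umbral_X_pow_mul {R : Type*} [CommRing R] (x y : R) {N i : ℕ} (hi : i ≤ N) :
    umbral x (X ^ (N - i) * (X + C y) ^ i)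
      = ∑ p ∈ range (i + 1), (i.choose p : R) * y ^ p * eulerian x (N - p) := by
  rw [add_comm X, add_pow, mul_sum, map_sum]
  refine sum_congr rfl fun p hp => ?_
  have hp' := mem_range.1 hp
  have : N - p = (N - i) + (i - p) := by omega
  rw [this, ← umbral_X_pow x, ← umbral_C_mul]
  congr 1
  simp only [map_mul, map_pow, map_natCast, pow_add]
  ring

theorem binomialEulerian_eq {R : Type*} [CommRing R] (x : R) (n : ℕ) : binomialEulerian x n
    = ∑ p ∈ range (n + 1), (n.choose p : R) * x ^ p * eulerian x (n - p) := by
  rw [binomialEulerian, ← umbral_X_pow_mul x x le_rfl]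
  simp

@[simp] theorem eval_binomialEulerian (x : ℝ) (n : ℕ) :
    (binomialEulerian (X : ℝ[X]) n).eval x = binomialEulerian x n := by
  simp [binomialEulerian_eq, eval_finsetSum]

/-- Only the term `X ^ N`, which occurs for `i = N`, has degree as large as `N`. -/
theorem coeff_umbral_X_pow_mul {N i : ℕ} (hi : i ≤ N) (hN : 0 < N) :
    (umbral (X : ℝ[X]) (X ^ (N - i) * (X + C X) ^ i)).natDegree ≤ N ∧
      (umbral (X : ℝ[X]) (X ^ (N - i) * (X + C X) ^ i)).coeff N = if i = N then 1 else 0 := by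
  have hlow : ∀ p < N, ((i.choose p : ℝ[X]) * X ^ p * eulerian X (N - p)).natDegree ≤ N - 1 := by
    intro p hp
    refine natDegree_mul_le_of_le (m := p) (n := N - p - 1) ?_ (natDegree_eulerian_le _)
      |>.trans (by omega)
    exact (natDegree_natCast_mul_le _ _).trans (natDegree_X_pow_le p)
  rw [umbral_X_pow_mul X X hi, sum_range_succ]
  have h1 : (∑ p ∈ range i, (i.choose p : ℝ[X]) * X ^ p * eulerian X (N - p)).natDegree ≤ N - 1 :=
    natDegree_sum_le_of_forall_le _ _ fun p hp => hlow p (by have := mem_range.1 hp; omega)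
  rcases hi.eq_or_lt with rfl | hlt
  · simp only [Nat.choose_self, Nat.cast_one, one_mul, tsub_self, eulerian_zero, mul_one, if_true]
    refine ⟨natDegree_add_le_of_degree_le (h1.trans (by omega)) (natDegree_X_pow_le i), ?_⟩
    rw [coeff_add, coeff_eq_zero_of_natDegree_lt (h1.trans_lt (by omega)), coeff_X_pow, if_pos rfl,
      zero_add]
  · have h2 := natDegree_add_le_of_degree_le h1 (hlow i hlt)
    rw [if_neg hlt.ne]
    exact ⟨h2.trans (by omega), coeff_eq_zero_of_natDegree_lt (h2.trans_lt (by omega))⟩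

theorem monic_binomialEulerian (n : ℕ) : (binomialEulerian (X : ℝ[X]) (n + 1)).Monic ∧
    (binomialEulerian (X : ℝ[X]) (n + 1)).natDegree = n + 1 := by
  have h := coeff_umbral_X_pow_mul (le_refl (n + 1)) n.succ_pos
  simp only [tsub_self, pow_zero, one_mul, if_true] at h
  exact ⟨monic_of_natDegree_le_of_coeff_eq_one _ h.1 h.2,
    natDegree_eq_of_le_of_coeff_ne_zero h.1 (ne_of_eq_of_ne h.2 one_ne_zero)⟩

theorem neg_of_binomialEulerian_eq_zero {x : ℝ} {n : ℕ} (h : binomialEulerian x n = 0) :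
    x < 0 := by
  by_contra! hx
  refine lt_irrefl (0 : ℝ) (lt_of_lt_of_eq ?_ h)
  rw [binomialEulerian_eq]
  refine sum_pos' (fun p _ => ?_) ⟨0, by simp, by simpa using eulerian_pos hx n⟩
  have := (eulerian_pos hx (n - p)).le
  positivity

theorem one_sub_pow_mul_binomialEulerian (x : ℝ) (N : ℕ) :
    (1 - x) ^ N * binomialEulerian x N
      = ∑ l ∈ range (N + 1), (N.choose l : ℝ) * (-x) ^ l * refinedEulerian x N l := by
  rw [← one_sub_pow_mul_umbral_left x le_rfl, binomialEulerian]
  simp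

/-- The Eulerian polynomial `A (n + 1)` strictly interlaces the binomial Eulerian polynomial. -/
theorem derivative_eulerian_mul_binomialEulerian_neg {x : ℝ} {n : ℕ}
    (h : eulerian x (n + 1) = 0) :
    (eulerian (X : ℝ[X]) (n + 1)).derivative.eval x * binomialEulerian x (n + 1) < 0 := by
  have hx := neg_of_eulerian_eq_zero h
  have hp := (isSimplyRealRooted_eulerian_and_pos n).2 x h
  have hs := eulerian_mul_sum_neg h (left_ne_zero_of_mul hp.ne')
    (w := fun l => ((n + 1).choose l : ℝ) * (-x) ^ l) fun l hl =>
      mul_pos (by exact_mod_cast Nat.choose_pos hl) (pow_pos (by linarith) _)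
  rw [← one_sub_pow_mul_binomialEulerian, mul_left_comm] at hs
  have h1 : eulerian x n * binomialEulerian x (n + 1) < 0 := by
    have : 0 < (1 - x) ^ (n + 1) := pow_pos (by linarith) _
    exact neg_of_mul_neg_right hs this.le
  by_contra! hc
  nlinarith [mul_pos hp (neg_pos.2 h1), sq_nonneg (eulerian x n)]

theorem isSimplyRealRooted_binomialEulerian (n : ℕ) :
    IsSimplyRealRooted (binomialEulerian (X : ℝ[X]) (n + 1)) ∧
      ∀ β, binomialEulerian β (n + 1) = 0 →
        0 < eulerian β (n + 1) * (binomialEulerian (X : ℝ[X]) (n + 1)).derivative.eval β := by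
  have hA := (isSimplyRealRooted_eulerian_and_pos n).1
  obtain ⟨hm, hd⟩ := monic_binomialEulerian n
  have hlt : ∀ α, (eulerian (X : ℝ[X]) (n + 1)).eval α = 0 →
      (eulerian (X : ℝ[X]) (n + 1)).derivative.eval α
        * (binomialEulerian (X : ℝ[X]) (n + 1)).eval α < 0 := by
    intro α hα
    rw [eval_eulerian] at hα
    rw [eval_binomialEulerian]
    exact derivative_eulerian_mul_binomialEulerian_neg hα
  refine ⟨hA.of_interlace hm (by rw [hd, natDegree_eulerian_succ n]) hlt, fun β hβ => ?_⟩
  have := hA.eval_mul_derivative_pos (by rw [hd, natDegree_eulerian_succ n])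
    (by simp [hm.leadingCoeff]) hlt β (by rwa [eval_binomialEulerian])
  rwa [eval_eulerian] at this

theorem choose_mul_choose_le {i N j m : ℕ} (hi : i ≤ N) (hj : j ≤ m) :
    i.choose m * N.choose j ≤ i.choose j * N.choose m := by
  rcases le_or_gt m i with hm | hm
  · have h1 := Nat.choose_mul (n := i) hj
    have h2 := Nat.choose_mul (n := N) hj
    refine Nat.le_of_mul_le_mul_right ?_ (Nat.choose_pos hj)
    calc i.choose m * N.choose j * m.choose j = i.choose j * N.choose j * (i - j).choose (m - j) := by
          linear_combination N.choose j * h1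
      _ ≤ i.choose j * N.choose j * (N - j).choose (m - j) :=
          Nat.mul_le_mul_left _ (Nat.choose_le_choose _ (by omega))
      _ = i.choose j * N.choose m * m.choose j := by
          linear_combination -(i.choose j * h2)
  · rw [Nat.choose_eq_zero_of_lt hm, zero_mul]; exact Nat.zero_le _

/-- At a root of the binomial Eulerian polynomial, the single sign change of the refined Eulerian
polynomials and the monotonicity of the ratios `C(i, l) / C(N, l)` in `l` determine the signs of two
families of sums. -/
theorem exists_sign_sum_choose {x : ℝ} {N : ℕ} (h : binomialEulerian x N = 0) :
    ∃ ε : ℝ, (ε = 1 ∨ ε = -1) ∧ ∀ i ≤ N,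
      0 ≤ ε * ∑ l ∈ range (N + 1), (i.choose l : ℝ) * (-x) ^ l * refinedEulerian x N l ∧
      ε * ∑ l ∈ range (N + 1), (i.choose (N - l) : ℝ) * (-x) ^ l * refinedEulerian x N l ≤ 0 := by
  have hx := neg_of_binomialEulerian_eq_zero h
  obtain ⟨ε, hε, m, hpos, hneg⟩ := hasOneSignChange_refinedEulerian hx N
  set a : ℕ → ℝ := fun l => (-x) ^ l * (ε * refinedEulerian x N l) with ha
  have hsum : ∑ l ∈ range (N + 1), (N.choose l : ℝ) * a l = 0 := by
    have := one_sub_pow_mul_binomialEulerian x N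
    rw [h, mul_zero] at this
    rw [← mul_zero ε, this, mul_sum]
    exact sum_congr rfl fun l _ => by simp only [ha]; ring
  have hapos : ∀ l < m, l ≤ N → 0 ≤ a l := fun l hl hlN =>
    mul_nonneg (pow_nonneg (by linarith) _) (hpos l hl hlN)
  have haneg : ∀ l, m ≤ l → l ≤ N → a l ≤ 0 := fun l hl hlN =>
    mul_nonpos_of_nonneg_of_nonpos (pow_nonneg (by linarith) _) (hneg l hl hlN)
  have hm : m ≤ N := by
    by_contra! hm
    have hz := (sum_eq_zero_iff_of_nonneg fun l hl =>
      mul_nonneg (Nat.cast_nonneg _) (hapos l (by have := mem_range.1 hl; omega)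
        (by have := mem_range.1 hl; omega))).1 hsum
    obtain ⟨j, hj, hj0⟩ := exists_refinedEulerian_ne_zero hx N
    have h1 := hz j (mem_range.2 (by omega))
    have h2 : (N.choose j : ℝ) ≠ 0 := by exact_mod_cast (Nat.choose_pos hj).ne'
    have h3 : ε ≠ 0 := by rcases hε with rfl | rfl <;> norm_num
    exact mul_ne_zero h2 (mul_ne_zero (pow_ne_zero _ (by linarith)) (mul_ne_zero h3 hj0)) h1
  have hmN : (0 : ℝ) < N.choose m := by exact_mod_cast Nat.choose_pos hm
  have hconv : ∀ u : ℕ → ℝ, ε * ∑ l ∈ range (N + 1), u l * (-x) ^ l * refinedEulerian x N l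
      = ∑ l ∈ range (N + 1), u l * a l := fun u => by
    rw [mul_sum]
    exact sum_congr rfl fun l _ => by simp only [ha]; ring
  have hcmp : ∀ (u : ℕ → ℝ) (c : ℝ), (N.choose m : ℝ) * ∑ l ∈ range (N + 1), u l * a l
      = ∑ l ∈ range (N + 1), (u l * N.choose m - c * N.choose l) * a l := fun u c => by
    have : ∑ l ∈ range (N + 1), (u l * N.choose m - c * N.choose l) * a l
        = N.choose m * ∑ l ∈ range (N + 1), u l * a l
          - c * ∑ l ∈ range (N + 1), (N.choose l : ℝ) * a l := by
      rw [mul_sum, mul_sum, ← sum_sub_distrib]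
      exact sum_congr rfl fun l _ => by ring
    rw [this, hsum, mul_zero, sub_zero]
  refine ⟨ε, hε, fun i hi => ⟨?_, ?_⟩⟩
  · rw [hconv fun l => (i.choose l : ℝ)]
    refine nonneg_of_mul_nonneg_right (a := (N.choose m : ℝ)) ?_ hmN
    rw [hcmp _ (i.choose m)]
    refine sum_nonneg fun l hl => ?_
    have hlN : l ≤ N := by have := mem_range.1 hl; omega
    rcases lt_or_ge l m with hlm | hlm
    · refine mul_nonneg (sub_nonneg.2 ?_) (hapos l hlm hlN)
      exact_mod_cast choose_mul_choose_le hi hlm.le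
    · refine mul_nonneg_of_nonpos_of_nonpos (sub_nonpos.2 ?_) (haneg l hlm hlN)
      exact_mod_cast choose_mul_choose_le hi hlm
  · rw [hconv fun l => (i.choose (N - l) : ℝ)]
    refine nonpos_of_mul_nonpos_right (a := (N.choose m : ℝ)) ?_ hmN
    rw [hcmp _ (i.choose (N - m))]
    refine sum_nonpos fun l hl => ?_
    have hlN : l ≤ N := by have := mem_range.1 hl; omega
    rw [← Nat.choose_symm hm, ← Nat.choose_symm hlN]
    rcases lt_or_ge l m with hlm | hlm
    · refine mul_nonpos_of_nonpos_of_nonneg (sub_nonpos.2 ?_) (hapos l hlm hlN)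
      exact_mod_cast choose_mul_choose_le hi (by omega : N - m ≤ N - l)
    · refine mul_nonpos_of_nonneg_of_nonpos (sub_nonneg.2 ?_) (haneg l hlm hlN)
      exact_mod_cast choose_mul_choose_le hi (by omega : N - l ≤ N - m)

end Binomial

/-! ### Real-rootedness of positive combinations -/

section Combination

variable {R S : Type*} [CommRing R] [CommRing S]

/-- The combination of the values of the umbral functional at `t ^ (N - i) * (t + x) ^ i` with
weights `w i`, for `i ≤ N`. -/
def umbralSum (x : R) (w : ℕ → R) (N : ℕ) : R :=
  ∑ i ∈ range (N + 1), w i * umbral x (X ^ (N - i) * (X + C x) ^ i)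

/-- The combination of the values of the umbral functional at
`(t + x - 1) ^ (N - i) * (t + x) ^ i` with weights `w i`, for `i ≤ N`. For constant weights
and as a polynomial in `x`, it is the reversal of `umbralSum` with respect to degree `N`. -/
def umbralSumRev (x : R) (w : ℕ → R) (N : ℕ) : R :=
  ∑ i ∈ range (N + 1), w i * umbral x ((X + C (x - 1)) ^ (N - i) * (X + C x) ^ i)

theorem map_umbralSum (φ : R →+* S) (x : R) (w : ℕ → R) (N : ℕ) :
    φ (umbralSum x w N) = umbralSum (φ x) (fun i => φ (w i)) N := by
  simp [umbralSum, map_umbral]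

theorem map_umbralSumRev (φ : R →+* S) (x : R) (w : ℕ → R) (N : ℕ) :
    φ (umbralSumRev x w N) = umbralSumRev (φ x) (fun i => φ (w i)) N := by
  simp [umbralSumRev, map_umbral]

theorem umbral_shift (x : R) (k i : ℕ) : umbral x ((X + C (x - 1)) ^ k * (X + C x) ^ i)
    = x * umbral x (X ^ k * (X + C 1) ^ i) - (x - 1) * if k = 0 then 1 else 0 := by
  have h := umbral_comp_shift x (X ^ k * (X + C 1) ^ i)
  have e : ((X : R[X]) ^ k * (X + C 1) ^ i).comp (X + C (x - 1))
      = (X + C (x - 1)) ^ k * (X + C x) ^ i := by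
    simp only [mul_comp, pow_comp, add_comp, X_comp, one_comp, map_sub, map_one]
    ring
  rw [← e, h]
  rcases k with _ | k <;> simp

theorem natDegree_umbral_shift_le {N i : ℕ} (hi : i ≤ N) (hN : 0 < N) :
    (umbral (X : ℝ[X]) ((X + C (X - 1)) ^ (N - i) * (X + C X) ^ i)).natDegree ≤ N := by
  rw [umbral_shift, umbral_X_pow_mul X 1 hi]
  refine (natDegree_sub_le _ _).trans (max_le ?_ ?_)
  · refine (natDegree_mul_le_of_le (m := 1) (n := N - 1) natDegree_X_le
      (natDegree_sum_le_of_forall_le _ _ fun p _ => ?_)).trans (by omega)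
    rw [one_pow, mul_one]
    exact ((natDegree_natCast_mul_le _ _).trans (natDegree_eulerian_le _)).trans (by omega)
  · refine (natDegree_mul_le_of_le (m := 1) (n := 0) (natDegree_X_sub_C_le 1) ?_).trans (by omega)
    split_ifs <;> simp

theorem natDegree_umbralSumRev_le (w : ℕ → ℝ) {N : ℕ} (hN : 0 < N) :
    (umbralSumRev (X : ℝ[X]) (fun i => C (w i)) N).natDegree ≤ N :=
  natDegree_sum_le_of_forall_le _ _ fun _ hi => (natDegree_C_mul_le _ _).trans
    (natDegree_umbral_shift_le (by have := mem_range.1 hi; omega) hN)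

theorem natDegree_umbralSum_le (w : ℕ → ℝ) {N : ℕ} (hN : 0 < N) :
    (umbralSum (X : ℝ[X]) (fun i => C (w i)) N).natDegree ≤ N :=
  natDegree_sum_le_of_forall_le _ _ fun _ hi => (natDegree_C_mul_le _ _).trans
    (coeff_umbral_X_pow_mul (by have := mem_range.1 hi; omega) hN).1

theorem coeff_umbralSum (w : ℕ → ℝ) {N : ℕ} (hN : 0 < N) :
    (umbralSum (X : ℝ[X]) (fun i => C (w i)) N).coeff N = w N := by
  rw [umbralSum, finsetSum_coeff, sum_eq_single N]
  · rw [coeff_C_mul, (coeff_umbral_X_pow_mul le_rfl hN).2, if_pos rfl, mul_one]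
  · intro i hi hiN
    rw [coeff_C_mul, (coeff_umbral_X_pow_mul (by have := mem_range.1 hi; omega) hN).2, if_neg hiN,
      mul_zero]
  · simp

theorem natDegree_and_leadingCoeff_of_X_sub_one_mul {G Q : ℝ[X]} {M : ℕ} (hG : (X - 1) * G = Q)
    (hQ : Q.natDegree ≤ M + 1) (hc : Q.coeff (M + 1) ≠ 0) :
    G.natDegree = M ∧ G.leadingCoeff = Q.coeff (M + 1) := by
  have hm : ((X : ℝ[X]) - 1).Monic := monic_X_sub_C 1
  have hQd : Q.natDegree = M + 1 := natDegree_eq_of_le_of_coeff_ne_zero hQ hc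
  have hG0 : G ≠ 0 := by
    rintro rfl
    rw [mul_zero] at hG
    rw [← hG, coeff_zero] at hc
    exact hc rfl
  have hd : ((X : ℝ[X]) - 1).natDegree = 1 := natDegree_X_sub_C 1
  constructor
  · have := hm.natDegree_mul' hG0
    rw [hG, hQd, hd] at this
    omega
  · rw [← hQd, coeff_natDegree, ← hG, leadingCoeff_monic_mul hm]

variable {w : ℕ → ℝ} {N : ℕ} {G : ℝ[X]}

/-- With `E = umbralSum` and `E^rev = umbralSumRev`, the polynomial `(x E - E^rev) / (x - 1)` is
real-rooted. It is interlaced by the Eulerian polynomial `A N`: at the roots of `A N` all refined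
Eulerian polynomials have the same sign, and `E` and `E^rev` inherit it. -/
theorem im_eq_zero_of_mul_eq_X_mul_umbralSum_sub (hN : 0 < N) (hw : ∀ i ≤ N, 0 ≤ w i) (hwN : 0 < w N)
    (hG : (X - 1) * G = X * umbralSum X (fun i => C (w i)) N
      - umbralSumRev X (fun i => C (w i)) N)
    (z : ℂ) (hz : aeval z G = 0) : z.im = 0 := by
  obtain ⟨n, rfl⟩ : ∃ n, N = n + 1 := ⟨N - 1, by omega⟩
  have hc : (X * umbralSum (X : ℝ[X]) (fun i => C (w i)) (n + 1)
      - umbralSumRev X (fun i => C (w i)) (n + 1)).coeff (n + 1 + 1) = w (n + 1) := by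
    rw [coeff_sub, coeff_X_mul, coeff_umbralSum w hN, coeff_eq_zero_of_natDegree_lt
      ((natDegree_umbralSumRev_le w hN).trans_lt (Nat.lt_succ_self _)), sub_zero]
  obtain ⟨hd, hl⟩ := natDegree_and_leadingCoeff_of_X_sub_one_mul (M := n + 1) hG
    ((natDegree_sub_le _ _).trans (max_le
      ((natDegree_mul_le_of_le natDegree_X_le (natDegree_umbralSum_le w hN)).trans (by omega))
      ((natDegree_umbralSumRev_le w hN).trans (by omega)))) (by rw [hc]; exact hwN.ne')
  rw [hc] at hl
  refine (isSimplyRealRooted_eulerian_and_pos n).1.im_eq_zero_of_interlace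
    (by rw [hd, natDegree_eulerian_succ]) (by rwa [hl]) (fun α hα => ?_) z hz
  rw [eval_eulerian] at hα
  have hx := neg_of_eulerian_eq_zero hα
  set D := (eulerian (X : ℝ[X]) (n + 1)).derivative.eval α
  have key : ∀ u : ℕ → ℕ, D * ∑ l ∈ range (n + 1 + 1),
      (u l : ℝ) * (-α) ^ l * refinedEulerian α (n + 1) l ≤ 0 := fun u => by
    rw [mul_sum]
    refine sum_nonpos fun l hl => ?_
    rw [mul_left_comm]
    exact mul_nonpos_of_nonneg_of_nonpos
      (mul_nonneg (Nat.cast_nonneg _) (pow_nonneg (by linarith) _))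
      (derivative_eulerian_mul_nonpos hα (by have := mem_range.1 hl; omega))
  have h1 : D * umbralSum α w (n + 1) ≤ 0 := by
    rw [umbralSum, mul_sum]
    refine sum_nonpos fun i hi => ?_
    have hi' : i ≤ n + 1 := by have := mem_range.1 hi; omega
    rw [mul_left_comm]
    refine mul_nonpos_of_nonneg_of_nonpos (hw i hi') ?_
    have := key fun l => i.choose l
    rw [← one_sub_pow_mul_umbral_left α hi', mul_left_comm] at this
    exact nonpos_of_mul_nonpos_right this (pow_pos (by linarith) _)
  have h2 : D * umbralSumRev α w (n + 1) ≤ 0 := by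
    rw [umbralSumRev, mul_sum]
    refine sum_nonpos fun i hi => ?_
    have hi' : i ≤ n + 1 := by have := mem_range.1 hi; omega
    rw [mul_left_comm]
    refine mul_nonpos_of_nonneg_of_nonpos (hw i hi') ?_
    have := key fun l => i.choose (n + 1 - l)
    rw [← one_sub_pow_mul_umbral_right α hi', mul_left_comm, mul_left_comm D] at this
    exact nonpos_of_mul_nonpos_right (nonpos_of_mul_nonpos_right this
      (pow_pos (by linarith) _)) (pow_pos (by linarith) _)
  have hev := congrArg (evalRingHom α) hG
  simp only [map_mul, map_sub, map_umbralSum, map_umbralSumRev, map_one, coe_evalRingHom, eval_X,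
    eval_C] at hev
  have h3 : (α - 1) * (D * G.eval α) = α * (D * umbralSum α w (n + 1))
      - D * umbralSumRev α w (n + 1) := by linear_combination D * hev
  by_contra! hpos
  nlinarith [mul_nonneg_of_nonpos_of_nonpos hx.le h1]

/-- With `E = umbralSum` and `E^rev = umbralSumRev`, the polynomial `(x² E - E^rev) / (x - 1)` is
real-rooted. It is interlaced by the binomial Eulerian polynomial of degree `N`, at the roots of
which `E` and `E^rev` have opposite signs. -/
theorem im_eq_zero_of_mul_eq_X_sq_mul_umbralSum_sub (hN : 0 < N) (hw : ∀ i ≤ N, 0 ≤ w i) (hwN : 0 < w N)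
    (hG : (X - 1) * G = X ^ 2 * umbralSum X (fun i => C (w i)) N
      - umbralSumRev X (fun i => C (w i)) N)
    (z : ℂ) (hz : aeval z G = 0) : z.im = 0 := by
  obtain ⟨n, rfl⟩ : ∃ n, N = n + 1 := ⟨N - 1, by omega⟩
  have hc : (X ^ 2 * umbralSum (X : ℝ[X]) (fun i => C (w i)) (n + 1)
      - umbralSumRev X (fun i => C (w i)) (n + 1)).coeff (n + 1 + 1 + 1) = w (n + 1) := by
    rw [coeff_sub, add_assoc (n + 1) 1 1, coeff_X_pow_mul, coeff_umbralSum w hN,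
      coeff_eq_zero_of_natDegree_lt
      ((natDegree_umbralSumRev_le w hN).trans_lt (by omega)), sub_zero]
  obtain ⟨hd, hl⟩ := natDegree_and_leadingCoeff_of_X_sub_one_mul (M := n + 2) hG
    ((natDegree_sub_le _ _).trans (max_le
      ((natDegree_mul_le_of_le (natDegree_X_pow_le 2) (natDegree_umbralSum_le w hN)).trans
        (by omega))
      ((natDegree_umbralSumRev_le w hN).trans (by omega)))) (by rw [hc]; exact hwN.ne')
  rw [hc] at hl
  obtain ⟨hB, hBpos⟩ := isSimplyRealRooted_binomialEulerian n
  refine hB.im_eq_zero_of_interlace (by rw [hd, (monic_binomialEulerian n).2]) (by rwa [hl])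
    (fun β hβ => ?_) z hz
  rw [eval_binomialEulerian] at hβ
  have hx := neg_of_binomialEulerian_eq_zero hβ
  obtain ⟨ε, hε, hs⟩ := exists_sign_sum_choose hβ
  have hpos : ∀ i ≤ n + 1, 0 ≤ ε * umbral β (X ^ (n + 1 - i) * (X + C β) ^ i) := fun i hi => by
    have := (hs i hi).1
    rw [← one_sub_pow_mul_umbral_left β hi, mul_left_comm] at this
    exact nonneg_of_mul_nonneg_right this (pow_pos (by linarith) _)
  have hneg : ∀ i ≤ n + 1,
      ε * umbral β ((X + C (β - 1)) ^ (n + 1 - i) * (X + C β) ^ i) ≤ 0 := fun i hi => by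
    have := (hs i hi).2
    rw [← one_sub_pow_mul_umbral_right β hi, mul_left_comm, mul_left_comm ε] at this
    exact nonpos_of_mul_nonpos_right (nonpos_of_mul_nonpos_right this
      (pow_pos (by linarith) _)) (pow_pos (by linarith) _)
  have h1 : 0 ≤ ε * umbralSum β w (n + 1) := by
    rw [umbralSum, mul_sum]
    refine sum_nonneg fun i hi => ?_
    have hi' : i ≤ n + 1 := by have := mem_range.1 hi; omega
    rw [mul_left_comm]
    exact mul_nonneg (hw i hi') (hpos i hi')
  have h2 : ε * umbralSumRev β w (n + 1) ≤ 0 := by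
    rw [umbralSumRev, mul_sum]
    refine sum_nonpos fun i hi => ?_
    have hi' : i ≤ n + 1 := by have := mem_range.1 hi; omega
    rw [mul_left_comm]
    exact mul_nonpos_of_nonneg_of_nonpos (hw i hi') (hneg i hi')
  have hev := congrArg (evalRingHom β) hG
  simp only [map_mul, map_sub, map_pow, map_umbralSum, map_umbralSumRev, map_one, coe_evalRingHom,
    eval_X, eval_C] at hev
  have h3 : (β - 1) * (ε * G.eval β) = β ^ 2 * (ε * umbralSum β w (n + 1))
      - ε * umbralSumRev β w (n + 1) := by linear_combination ε * hev
  have hG0 : ε * G.eval β ≤ 0 := by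
    by_contra! hc
    nlinarith [mul_nonneg (sq_nonneg β) h1]
  -- The sign `ε` is that of the derivative, since it is that of `A (n + 1)`, the term `i = 0`.
  have hA := hpos 0 (Nat.zero_le _)
  rw [pow_zero, mul_one, tsub_zero, umbral_X_pow] at hA
  have hD := hBpos β hβ
  rcases hε with rfl | rfl
  · have hA' : 0 < eulerian β (n + 1) := lt_of_le_of_ne (by linarith) (left_ne_zero_of_mul hD.ne').symm
    have := pos_of_mul_pos_right hD hA'.le
    exact mul_nonpos_of_nonneg_of_nonpos this.le (by linarith)
  · have hA' : eulerian β (n + 1) < 0 := lt_of_le_of_ne (by linarith) (left_ne_zero_of_mul hD.ne')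
    have := neg_of_mul_pos_right hD hA'.le
    exact mul_nonpos_of_nonpos_of_nonneg this.le (by linarith)

end Combination

/-! ### The weights of the uniform matroid -/

section Weights

theorem sum_range_choose_add (d N p : ℕ) :
    ∑ i ∈ range (N + 1), (d + i).choose (d + p) = (d + N + 1).choose (d + p + 1) := by
  induction N with
  | zero => simp [Nat.choose_succ_succ' d (d + p), Nat.choose_eq_zero_of_lt (n := d) (k := d + p + 1)]
  | succ N ih => rw [sum_range_succ, ih, Nat.choose_succ_succ' (d + (N + 1)), add_comm, ← add_assoc]

theorem sum_choose_mul_choose (d : ℕ) {N p : ℕ} (hp : p ≤ N) :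
    ∑ i ∈ range (N + 1), (d + i).choose i * i.choose p
      = (N + 1 + d).choose (N - p) * (d + p).choose p := by
  have h1 : ∀ i ∈ range (N + 1), (d + i).choose i * i.choose p
      = (d + i).choose (d + p) * (d + p).choose p := by
    intro i _
    have := Nat.choose_mul (n := d + i) (k := d + p) (s := d) (by omega)
    rw [Nat.add_sub_cancel_left, Nat.add_sub_cancel_left] at this
    rw [Nat.choose_symm_add.symm, ← this, Nat.choose_symm_add]
  rw [sum_congr rfl h1, ← sum_mul, sum_range_choose_add]
  congr 1
  rw [Nat.choose_symm_of_eq_add (n := N + 1 + d) (a := N - p) (b := d + p + 1) (by omega)]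
  congr 1
  omega

/-- Expansion of the weighted sums at the numbers `C(n, k) * C(n - k - 1, N - k)`, for
`n = N + 1 + d`, which come from the Möbius function of the uniform matroid of rank `N + 1`
on `n` elements. -/
theorem sum_choose_mul_umbral {R : Type*} [CommRing R] (x y : R) (d N : ℕ) :
    ∑ i ∈ range (N + 1), ((d + i).choose i : R) * umbral x (X ^ (N - i) * (X + C y) ^ i)
      = ∑ k ∈ range (N + 1), ((N + 1 + d).choose k * (N + 1 + d - k - 1).choose (N - k) : ℕ)
        * (eulerian x k * y ^ (N - k)) := by
  have h1 : ∀ i ∈ range (N + 1), ((d + i).choose i : R) * umbral x (X ^ (N - i) * (X + C y) ^ i)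
      = ∑ p ∈ range (N + 1), (((d + i).choose i * i.choose p : ℕ) : R)
        * (eulerian x (N - p) * y ^ p) := by
    intro i hi
    have hi' : i ≤ N := by have := mem_range.1 hi; omega
    rw [umbral_X_pow_mul x y hi', mul_sum]
    refine Eq.trans (sum_congr rfl fun p _ => ?_) (sum_subset (range_subset_range.2 (by omega))
      fun p _ hp => ?_)
    · push_cast; ring
    · rw [mem_range, not_lt] at hp
      rw [Nat.choose_eq_zero_of_lt (n := i) (by omega)]
      simp
  rw [sum_congr rfl h1, sum_comm, ← sum_range_reflect _ (N + 1)]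
  refine sum_congr rfl fun k hk => ?_
  have hk' : k ≤ N := by have := mem_range.1 hk; omega
  have e1 : N + 1 - 1 - k = N - k := by omega
  have e2 : N - (N - k) = k := by omega
  have e3 : N + 1 + d - k - 1 = d + (N - k) := by omega
  rw [e1, ← sum_mul, ← Nat.cast_sum, sum_choose_mul_choose d (Nat.sub_le _ _), e2, e3]

end Weights

/-! ### Recursions for the dual Chow functions -/

section DualRecursion

variable {P : Type*} [PartialOrder P] [LocallyFiniteOrder P]

theorem incidenceAlgebra_neg_mul (a b : IncidenceAlgebra ℤ[X] P) : -a * b = -(a * b) := by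
  refine IncidenceAlgebra.ext fun s t _ => ?_
  simp only [IncidenceAlgebra.mul_apply, IncidenceAlgebra.neg_apply, neg_mul, sum_neg_distrib]

variable [DecidableEq P]

theorem rev_sgn_mu_apply (ρ : WeakRank P) (s t : P) :
    rev ρ (sgn ρ (IncidenceAlgebra.mu ℤ[X])) s t
      = sgn ρ (IncidenceAlgebra.mu ℤ[X]) s t * X ^ ρ.rk s t := by
  have h := eq_C_of_natDegree_eq_zero
    ((natDegree_sgn ρ (IncidenceAlgebra.mu ℤ[X]) s t).trans (natDegree_mu s t))
  change reflect _ (sgn ρ (IncidenceAlgebra.mu ℤ[X]) s t) = _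
  rw [h, reflect_C]

variable [DecidableLE P]

theorem dualChow_mul_bar (ρ : WeakRank P) : dualChow ρ * bar (dualKernel ρ (chi ρ)) = -1 := by
  rw [dualChow, chow, incidenceAlgebra_neg_mul, Ring.inverse_mul_cancel _ (isUnit_bar _)]

/-- In terms of the right Kazhdan–Lusztig–Stanley function `f`, the dual Chow function satisfies
`H* (f^rev - x f) = -(x - 1) f`. -/
theorem sum_dualChow_mul (ρ : WeakRank P) (s t : P) :
    ∑ w ∈ Icc s t, dualChow ρ s w
        * (sgn ρ (IncidenceAlgebra.mu ℤ[X]) w t * (X ^ ρ.rk w t - X))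
      = -(X - 1) * sgn ρ (IncidenceAlgebra.mu ℤ[X]) s t := by
  set f : IncidenceAlgebra ℤ[X] P := sgn ρ (IncidenceAlgebra.mu ℤ[X])
  set κ := dualKernel ρ (chi ρ)
  have hf : IsRightKLS ρ κ f := isRightKLS_sgn_mu ρ
  have hκf : κ * f = rev ρ f := by
    rw [hf.eq_mul, mul_assoc, Ring.inverse_mul_cancel _ hf.isUnit, mul_one]
  have hbar : ((X : ℤ[X]) - 1) • bar κ = κ - (X : ℤ[X]) • (1 : IncidenceAlgebra ℤ[X] P) := by
    refine IncidenceAlgebra.ext fun a b hab => ?_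
    rw [IncidenceAlgebra.constSMul_apply, IncidenceAlgebra.sub_apply,
      IncidenceAlgebra.constSMul_apply, IncidenceAlgebra.one_apply]
    rcases hab.eq_or_lt with rfl | h
    · rw [(isKernel_dualKernel_chi ρ).diag]
      simp [bar]
    · have := mul_bar_dualKernel_chi ρ h
      rw [map_one] at this
      rw [smul_eq_mul, this, if_neg h.ne]
      simp [κ]
  have h1 : dualChow ρ * (rev ρ f - (X : ℤ[X]) • f) = -(((X : ℤ[X]) - 1) • f) := by
    calc dualChow ρ * (rev ρ f - (X : ℤ[X]) • f)
        = dualChow ρ * ((κ - (X : ℤ[X]) • (1 : IncidenceAlgebra ℤ[X] P)) * f) := by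
          rw [sub_mul, hκf, smul_mul_assoc, one_mul]
      _ = ((X : ℤ[X]) - 1) • (dualChow ρ * bar κ * f) := by
          rw [← hbar, smul_mul_assoc, mul_smul_comm, mul_assoc]
      _ = ((X : ℤ[X]) - 1) • (-1 * f) := by rw [dualChow_mul_bar]
      _ = _ := by
          rw [incidenceAlgebra_neg_mul, one_mul]
          exact IncidenceAlgebra.ext fun a b _ => smul_neg ((X : ℤ[X]) - 1) (f a b)
  have h2 := congrArg (fun a : IncidenceAlgebra ℤ[X] P => a s t) h1
  simp only [IncidenceAlgebra.mul_apply, IncidenceAlgebra.neg_apply,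
    IncidenceAlgebra.constSMul_apply, IncidenceAlgebra.sub_apply, smul_eq_mul] at h2
  rw [neg_mul, ← h2]
  refine sum_congr rfl fun w _ => ?_
  rw [rev_sgn_mu_apply]
  ring

theorem dualChow_self (ρ : WeakRank P) (s : P) : dualChow ρ s s = 1 := by
  have h := congrArg (fun a : IncidenceAlgebra ℤ[X] P => a s s) (dualChow_mul_bar ρ)
  simp only [IncidenceAlgebra.mul_apply, Icc_self, sum_singleton, IncidenceAlgebra.neg_apply,
    IncidenceAlgebra.one_apply, if_true] at h
  simpa [bar] using h

theorem dualAugChow_apply (ρ : WeakRank P) (s t : P) :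
    dualAugChow ρ s t = ∑ w ∈ Icc s t, dualChow ρ s w
        * (sgn ρ (IncidenceAlgebra.mu ℤ[X]) w t * X ^ ρ.rk w t) := by
  have h : rightKLS ρ (dualKernel ρ (chi ρ)) = sgn ρ (IncidenceAlgebra.mu ℤ[X]) :=
    (isRightKLS_rightKLS_dualKernel_chi ρ).unique (isRightKLS_sgn_mu ρ)
  rw [dualAugChow, rightAugChow, h, IncidenceAlgebra.mul_apply]
  exact sum_congr rfl fun w _ => by rw [rev_sgn_mu_apply, dualChow]

end DualRecursion

/-! ### The lattice of flats of a uniform matroid -/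

section Uniform

variable {r n : ℕ}

theorem uniformMatroid_indep_iff {I : Set (Fin n)} :
    (uniformMatroid r n).Indep I ↔ I.ncard ≤ r := by
  simp [uniformMatroid]

theorem isFlat_uniformMatroid_iff {F : Set (Fin n)} :
    (uniformMatroid r n).IsFlat F ↔ F = Set.univ ∨ F.ncard < r := by
  rw [Matroid.isFlat_iff_closure_eq]
  refine ⟨fun h => ?_, ?_⟩
  · by_contra! hc
    obtain ⟨I, hIF, hI⟩ := Set.exists_subset_card_eq hc.2
    refine hc.1 (Set.eq_univ_of_forall fun x => ?_)
    rw [← h]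
    refine (uniformMatroid r n).closure_subset_closure hIF ?_
    have hind : (uniformMatroid r n).Indep I := uniformMatroid_indep_iff.2 hI.le
    rw [hind.mem_closure_iff']
    refine ⟨Set.mem_univ _, fun hx => ?_⟩
    by_contra hxI
    have := uniformMatroid_indep_iff.1 hx
    rw [Set.ncard_insert_of_notMem hxI] at this
    omega
  · rintro (rfl | h)
    · exact (uniformMatroid r n).closure_ground
    · have hind : (uniformMatroid r n).Indep F := uniformMatroid_indep_iff.2 h.le
      refine Set.Subset.antisymm (fun x hx => ?_) ((uniformMatroid r n).subset_closure F)
      rw [hind.mem_closure_iff'] at hx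
      refine hx.2 (uniformMatroid_indep_iff.2 ?_)
      exact (Set.ncard_insert_le x F).trans h

theorem toNat_eRk_uniformMatroid {F : Set (Fin n)} (h : F.ncard ≤ r) :
    ((uniformMatroid r n).eRk F).toNat = F.ncard := by
  rw [(uniformMatroid_indep_iff.2 h).eRk_eq_encard, Set.ncard_def]

theorem toNat_eRk_uniformMatroid_univ (h : r ≤ n) :
    ((uniformMatroid r n).eRk Set.univ).toNat = r := by
  obtain ⟨I, -, hI⟩ := Set.exists_subset_card_eq (s := (Set.univ : Set (Fin n))) (n := r)
    (by simpa [Set.ncard_univ] using h)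
  have h1 : (uniformMatroid r n).eRk Set.univ = (r : ℕ∞) := by
    refine le_antisymm (Matroid.eRk_le_iff.2 fun J _ hJ => ?_) (Matroid.le_eRk_iff.2
      ⟨I, Set.subset_univ _, uniformMatroid_indep_iff.2 hI.le, ?_⟩)
    · rw [← (Set.toFinite J).cast_ncard_eq]
      exact_mod_cast uniformMatroid_indep_iff.1 hJ
    · rw [← (Set.toFinite I).cast_ncard_eq, hI]
  rw [h1, ENat.toNat_natCast]

local notation "𝓕" => Flats (uniformMatroid r n)

theorem Flats.coe_top : ((⊤ : 𝓕) : Set (Fin n)) = Set.univ := rfl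

theorem Flats.ncard_lt {F : 𝓕} (h : F ≠ ⊤) : F.1.ncard < r :=
  (isFlat_uniformMatroid_iff.1 F.2).resolve_left fun e => h (Subtype.ext e)

theorem Flats.ne_top (hrn : r ≤ n) {F : 𝓕} (h : F.1.ncard < r) : F ≠ ⊤ := by
  rintro rfl
  rw [Flats.coe_top, Set.ncard_univ, Nat.card_fin] at h
  omega

theorem Flats.bot_eq (hr : 0 < r) : ((⊥ : 𝓕) : Set (Fin n)) = ∅ := by
  have : (uniformMatroid r n).IsFlat ∅ := isFlat_uniformMatroid_iff.2 (Or.inr (by simpa using hr))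
  exact this.closure

theorem flatsRank_rk_of_ne_top {F G : 𝓕} (hF : F ≠ ⊤) (hG : G ≠ ⊤) :
    (flatsRank (uniformMatroid r n)).rk F G = G.1.ncard - F.1.ncard := by
  change ((uniformMatroid r n).eRk G.1).toNat - ((uniformMatroid r n).eRk F.1).toNat = _
  rw [toNat_eRk_uniformMatroid (Flats.ncard_lt hF).le,
    toNat_eRk_uniformMatroid (Flats.ncard_lt hG).le]

theorem flatsRank_rk_top (hrn : r ≤ n) {F : 𝓕} (hF : F ≠ ⊤) :
    (flatsRank (uniformMatroid r n)).rk F ⊤ = r - F.1.ncard := by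
  change ((uniformMatroid r n).eRk Set.univ).toNat - ((uniformMatroid r n).eRk F.1).toNat = _
  rw [toNat_eRk_uniformMatroid (Flats.ncard_lt hF).le, toNat_eRk_uniformMatroid_univ hrn]

open Classical in
/-- The proper flats in an interval `[F, G]` are the sets between `F` and `G` with fewer than `r`
elements. -/
theorem sum_filter_ne_top {A : Type*} [AddCommMonoid A] (hrn : r ≤ n) {F G : 𝓕} (hFG : F ≤ G)
    (φ : ℕ → A) :
    ∑ w ∈ Icc F G with w ≠ ⊤, φ (w.1.ncard - F.1.ncard)
      = ∑ k ∈ range (r - F.1.ncard), (G.1.ncard - F.1.ncard).choose k • φ k := by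
  set D : Finset (Fin n) := (G.1 \ F.1).toFinset
  have hD : #D = G.1.ncard - F.1.ncard := by
    rw [← Set.ncard_eq_toFinset_card', Set.ncard_sdiff hFG]
  set ψ : ℕ → A := fun k => if k < r - F.1.ncard then φ k else 0
  have h1 : ∑ w ∈ Icc F G with w ≠ ⊤, φ (w.1.ncard - F.1.ncard)
      = ∑ S ∈ D.powerset with #S < r - F.1.ncard, φ #S := by
    refine sum_bij' (fun w _ => (w.1 \ F.1).toFinset)
      (fun S hS => ⟨F.1 ∪ S, isFlat_uniformMatroid_iff.2 (Or.inr ?_)⟩) ?_ ?_ ?_ ?_ ?_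
    · have := Set.ncard_union_le F.1 (S : Set (Fin n))
      rw [Set.ncard_coe_finset] at this
      have := (mem_filter.1 hS).2
      omega
    · intro w hw
      obtain ⟨hw, hwt⟩ := mem_filter.1 hw
      obtain ⟨hFw, hwG⟩ := mem_Icc.1 hw
      refine mem_filter.2 ⟨mem_powerset.2 (Set.toFinset_subset_toFinset.2
        (Set.sdiff_subset_sdiff_left hwG)), ?_⟩
      have h1 := Flats.ncard_lt hwt
      have h2 := Set.ncard_le_ncard hFw (Set.toFinite _)
      rw [← Set.ncard_eq_toFinset_card', Set.ncard_sdiff hFw]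
      omega
    · intro S hS
      obtain ⟨hS, hSc⟩ := mem_filter.1 hS
      rw [mem_powerset] at hS
      refine mem_filter.2 ⟨mem_Icc.2 ⟨Set.subset_union_left, Set.union_subset hFG fun x hx => ?_⟩,
        Flats.ne_top hrn ?_⟩
      · have := hS hx
        rw [Set.mem_toFinset] at this
        exact this.1
      · have := Set.ncard_union_le F.1 (S : Set (Fin n))
        rw [Set.ncard_coe_finset] at this
        change (F.1 ∪ (S : Set (Fin n))).ncard < r
        omega
    · intro w hw
      obtain ⟨hFw, -⟩ := mem_Icc.1 (mem_filter.1 hw).1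
      refine Subtype.ext ?_
      simp only [Set.coe_toFinset]
      exact Set.union_sdiff_cancel hFw
    · intro S hS
      have hS := mem_powerset.1 (mem_filter.1 hS).1
      ext x
      simp only [Set.mem_toFinset, Set.mem_sdiff, Set.mem_union, mem_coe]
      refine ⟨fun h => h.1.resolve_left h.2, fun h => ⟨Or.inr h, ?_⟩⟩
      have := hS h
      rw [Set.mem_toFinset] at this
      exact this.2
    · intro w hw
      obtain ⟨hFw, -⟩ := mem_Icc.1 (mem_filter.1 hw).1
      rw [← Set.ncard_eq_toFinset_card', Set.ncard_sdiff hFw]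
  have h2 : ∑ S ∈ D.powerset with #S < r - F.1.ncard, φ #S = ∑ S ∈ D.powerset, ψ #S := by
    rw [sum_filter]
  rw [h1, h2, sum_powerset_apply_card, hD]
  set c := G.1.ncard - F.1.ncard
  set m := r - F.1.ncard
  have e1 : ∑ k ∈ range (c + 1), c.choose k • ψ k = ∑ k ∈ range (c + 1 + m), c.choose k • ψ k := by
    refine sum_subset (range_subset_range.2 (by omega)) fun k _ hk => ?_
    rw [mem_range, not_lt] at hk
    rw [Nat.choose_eq_zero_of_lt (by omega), zero_smul]
  have e2 : ∑ k ∈ range m, c.choose k • φ k = ∑ k ∈ range (c + 1 + m), c.choose k • ψ k := by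
    refine Eq.trans (sum_congr rfl fun k hk => ?_)
      (sum_subset (range_subset_range.2 (by omega)) fun k _ hk => ?_)
    · rw [show ψ k = φ k from if_pos (mem_range.1 hk)]
    · rw [show ψ k = 0 from if_neg fun h => hk (mem_range.2 h), smul_zero]
  rw [e1, e2]

theorem Flats.ne_top_of_le {F G : 𝓕} (h : F ≤ G) (hG : G ≠ ⊤) : F ≠ ⊤ :=
  fun e => hG (top_le_iff.1 (e ▸ h))

open Classical in
/-- Below the top, the lattice of flats is Boolean. -/
theorem mu_of_ne_top (hrn : r ≤ n) {F G : 𝓕} (hFG : F ≤ G) (hG : G ≠ ⊤) :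
    IncidenceAlgebra.mu ℤ[X] F G = (-1) ^ (G.1.ncard - F.1.ncard) := by
  induction hk : G.1.ncard using Nat.strong_induction_on generalizing G with
  | _ k ih =>
    subst hk
    rcases hFG.eq_or_lt with rfl | hlt
    · simp
    have hF := Flats.ne_top_of_le hFG hG
    have hsum := sum_filter_ne_top hrn hFG (fun k => ((-1) ^ k : ℤ[X]))
    have hfil : (Icc F G).filter (· ≠ ⊤) = Icc F G :=
      filter_true_of_mem fun w hw => Flats.ne_top_of_le (mem_Icc.1 hw).2 hG
    have hc := Set.ncard_lt_ncard (show F.1 ⊂ G.1 from hlt) (Set.toFinite _)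
    have hG' := Flats.ncard_lt hG
    have hzero : ∑ k ∈ range (r - F.1.ncard), (G.1.ncard - F.1.ncard).choose k • ((-1) ^ k : ℤ[X])
        = 0 := by
      have h1 := congrArg (Int.castRingHom ℤ[X])
        (Int.alternating_sum_range_choose_of_ne (n := G.1.ncard - F.1.ncard) (by omega))
      rw [map_sum, map_zero] at h1
      rw [← h1]
      refine (sum_subset (range_subset_range.2 (by omega)) fun k _ hk => ?_).symm.trans
        (sum_congr rfl fun k _ => ?_)
      · rw [mem_range, not_lt] at hk
        rw [Nat.choose_eq_zero_of_lt (by omega), zero_smul]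
      · simp [nsmul_eq_mul, mul_comm]
    rw [hfil, hzero, Icc_eq_cons_Ico hFG, sum_cons] at hsum
    rw [IncidenceAlgebra.mu_eq_neg_sum_Ico_of_ne hlt.ne, sum_congr rfl fun w hw => ?_,
      eq_neg_of_add_eq_zero_left hsum]
    obtain ⟨hFw, hwG⟩ := mem_Ico.1 hw
    exact ih _ (Set.ncard_lt_ncard (show w.1 ⊂ G.1 from hwG) (Set.toFinite _)) hFw
      (Flats.ne_top_of_le hwG.le hG) rfl

open Classical in
theorem Ico_top_eq_filter (F : 𝓕) : Ico F ⊤ = (Icc F ⊤).filter (· ≠ ⊤) := by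
  ext w
  simp [lt_top_iff_ne_top]

open Classical in
theorem mu_top (hrn : r ≤ n) {F : 𝓕} (hF : F ≠ ⊤) :
    IncidenceAlgebra.mu ℤ[X] F ⊤ = (-1) ^ (r - F.1.ncard)
      * ((n - F.1.ncard - 1).choose (r - F.1.ncard - 1) : ℤ[X]) := by
  have hlt := Flats.ncard_lt hF
  have hsum := sum_filter_ne_top hrn (le_top : F ≤ ⊤) (fun k => ((-1) ^ k : ℤ[X]))
  rw [← Ico_top_eq_filter, Flats.coe_top, Set.ncard_univ, Nat.card_fin] at hsum
  rw [IncidenceAlgebra.mu_eq_neg_sum_Ico_of_ne hF, sum_congr rfl fun w hw =>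
    mu_of_ne_top hrn (mem_Ico.1 hw).1 (mem_Ico.1 hw).2.ne, hsum]
  obtain ⟨m, hm⟩ : ∃ m, r - F.1.ncard = m + 1 := ⟨r - F.1.ncard - 1, by omega⟩
  obtain ⟨c, hc⟩ : ∃ c, n - F.1.ncard = c + 1 := ⟨n - F.1.ncard - 1, by omega⟩
  have h1 := congrArg (Int.castRingHom ℤ[X])
    (Int.alternating_sum_range_choose_eq_choose (n := c) (m := m))
  rw [map_sum] at h1
  rw [hm, hc]
  simp only [Nat.add_sub_cancel]
  have h2 : ∑ k ∈ range (m + 1), (c + 1).choose k • ((-1) ^ k : ℤ[X])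
      = (-1) ^ m * (c.choose m : ℤ[X]) := by
    refine Eq.trans (sum_congr rfl fun k _ => ?_) (h1.trans ?_)
    · simp [nsmul_eq_mul, mul_comm]
    · simp
  rw [h2, pow_succ]
  ring

open Classical in
theorem sgn_mu_of_ne_top (hrn : r ≤ n) {F G : 𝓕} (hFG : F ≤ G) (hG : G ≠ ⊤) :
    sgn (flatsRank _) (IncidenceAlgebra.mu ℤ[X]) F G = 1 := by
  change (-1) ^ _ * IncidenceAlgebra.mu ℤ[X] F G = 1
  rw [mu_of_ne_top hrn hFG hG, flatsRank_rk_of_ne_top (Flats.ne_top_of_le hFG hG) hG, ← mul_pow]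
  simp

open Classical in
theorem sgn_mu_top (hrn : r ≤ n) {F : 𝓕} (hF : F ≠ ⊤) :
    sgn (flatsRank _) (IncidenceAlgebra.mu ℤ[X]) F ⊤
      = ((n - F.1.ncard - 1).choose (r - F.1.ncard - 1) : ℤ[X]) := by
  change (-1) ^ _ * IncidenceAlgebra.mu ℤ[X] F ⊤ = _
  rw [mu_top hrn hF, flatsRank_rk_top hrn hF, ← mul_assoc, ← mul_pow]
  simp

open Classical in
/-- The dual Chow polynomials of Boolean lattices are the Eulerian polynomials. -/
theorem dualChow_bot_of_ne_top (hrn : r ≤ n) {G : 𝓕} (hG : G ≠ ⊤) :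
    dualChow (flatsRank (uniformMatroid r n)) ⊥ G = eulerian X G.1.ncard := by
  induction hk : G.1.ncard using Nat.strong_induction_on generalizing G with
  | _ k ih =>
    subst hk
    have hr : 0 < r := lt_of_le_of_lt (Nat.zero_le _) (Flats.ncard_lt hG)
    have hbot : (⊥ : 𝓕).1.ncard = 0 := by rw [Flats.bot_eq hr, Set.ncard_empty]
    have hG' := Flats.ncard_lt hG
    have hrk : ∀ w ∈ Icc ⊥ G, (flatsRank (uniformMatroid r n)).rk w G = G.1.ncard - w.1.ncard :=
      fun w hw => flatsRank_rk_of_ne_top (Flats.ne_top_of_le (mem_Icc.1 hw).2 hG) hG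
    have h1 := sum_dualChow_mul (flatsRank (uniformMatroid r n)) ⊥ G
    rw [sgn_mu_of_ne_top hrn bot_le hG, mul_one, sum_congr rfl fun w hw => by
      rw [sgn_mu_of_ne_top hrn (mem_Icc.1 hw).2 hG, one_mul, hrk w hw]] at h1
    have h2 : ∑ w ∈ Icc ⊥ G, eulerian X w.1.ncard * (X ^ (G.1.ncard - w.1.ncard) - X)
        = -((X : ℤ[X]) - 1) := by
      have hsum := sum_filter_ne_top hrn (bot_le : ⊥ ≤ G)
        (fun k => eulerian (X : ℤ[X]) k * (X ^ (G.1.ncard - k) - X))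
      have hfil : (Icc ⊥ G).filter (· ≠ ⊤) = Icc ⊥ G :=
        filter_true_of_mem fun w hw => Flats.ne_top_of_le (mem_Icc.1 hw).2 hG
      simp only [hfil, hbot, tsub_zero] at hsum
      rw [hsum, ← sum_choose_mul_eulerian (X : ℤ[X]) G.1.ncard]
      refine (sum_subset (range_subset_range.2 (by omega)) fun k _ hk => ?_).symm.trans
        (sum_congr rfl fun k _ => ?_)
      · rw [mem_range, not_lt] at hk
        rw [Nat.choose_eq_zero_of_lt (by omega), zero_smul]
      · rw [nsmul_eq_mul]; ring
    rw [← h2, Icc_eq_cons_Ico bot_le, sum_cons, sum_cons, sum_congr rfl fun w hw => by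
      rw [ih _ (Set.ncard_lt_ncard (show w.1 ⊂ G.1 from (mem_Ico.1 hw).2) (Set.toFinite _))
        (Flats.ne_top_of_le (mem_Ico.1 hw).2.le hG) rfl]] at h1
    refine mul_right_cancel₀ ?_ (add_right_cancel h1)
    rw [tsub_self, pow_zero]
    intro h
    have := congrArg (eval 0) h
    simp at this

open Classical in
theorem sum_Ico_bot_top (hr : 0 < r) (hrn : r ≤ n) (φ : ℕ → ℤ[X]) :
    ∑ w ∈ Ico (⊥ : 𝓕) ⊤, φ w.1.ncard = ∑ k ∈ range r, (n.choose k : ℤ[X]) * φ k := by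
  have hbot : (⊥ : 𝓕).1.ncard = 0 := by rw [Flats.bot_eq hr, Set.ncard_empty]
  have hsum := sum_filter_ne_top hrn (bot_le : (⊥ : 𝓕) ≤ ⊤) φ
  rw [← Ico_top_eq_filter, Flats.coe_top, Set.ncard_univ, Nat.card_fin] at hsum
  simp only [hbot, tsub_zero] at hsum
  rw [hsum]
  exact sum_congr rfl fun k _ => nsmul_eq_mul _ _

open Classical in
theorem bot_ne_top (hr : 0 < r) (hrn : r ≤ n) : (⊥ : 𝓕) ≠ ⊤ :=
  Flats.ne_top hrn (by rw [Flats.bot_eq hr, Set.ncard_empty]; exact hr)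

end Uniform

/-! ### Real-rootedness -/

section RealRootedness

variable (d N : ℕ)

/-- The dual Chow polynomial of the uniform matroid of rank `N + 1` on `N + 1 + d` elements in terms
of Eulerian polynomials: the Möbius values `C(n - k - 1, N - k)` at the top turn the recursion
`sum_dualChow_mul` into a positive combination of umbral values. -/
theorem X_sub_one_mul_dualChowPolynomial :
    (X - 1) * dualChowPolynomial (uniformMatroid (N + 1) (N + 1 + d))
      = X * umbralSum X (fun i => ((d + i).choose i : ℤ[X])) N
        - umbralSumRev X (fun i => ((d + i).choose i : ℤ[X])) N := by
  classical
  have hrn : N + 1 ≤ N + 1 + d := by omega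
  have hne := bot_ne_top (r := N + 1) (Nat.succ_pos N) hrn
  have hbot : (⊥ : Flats (uniformMatroid (N + 1) (N + 1 + d))).1.ncard = 0 := by
    rw [Flats.bot_eq (Nat.succ_pos N), Set.ncard_empty]
  have h1 := sum_dualChow_mul (flatsRank (uniformMatroid (N + 1) (N + 1 + d))) ⊥ ⊤
  rw [sgn_mu_top hrn hne, hbot, Icc_eq_cons_Ico bot_le, sum_cons, sum_congr rfl fun w hw => by
    rw [dualChow_bot_of_ne_top hrn (mem_Ico.1 hw).2.ne, sgn_mu_top hrn (mem_Ico.1 hw).2.ne,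
      flatsRank_rk_top hrn (mem_Ico.1 hw).2.ne], WeakRank.self, pow_zero,
    sum_Ico_bot_top (Nat.succ_pos N) hrn fun k => eulerian (X : ℤ[X]) k
      * (((N + 1 + d - k - 1).choose (N + 1 - k - 1) : ℤ[X]) * (X ^ (N + 1 - k) - X))] at h1
  have hd : sgn (flatsRank (uniformMatroid (N + 1) (N + 1 + d))) (IncidenceAlgebra.mu ℤ[X]) ⊤ ⊤
      = 1 := by
    simp [sgn, WeakRank.self]
  rw [hd, one_mul] at h1
  have hE := sum_choose_mul_umbral (X : ℤ[X]) X d N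
  have hQ := sum_choose_mul_umbral (X : ℤ[X]) 1 d N
  have hrev : umbralSumRev (X : ℤ[X]) (fun i => ((d + i).choose i : ℤ[X])) N
      = X * ∑ i ∈ range (N + 1), ((d + i).choose i : ℤ[X])
          * umbral X (X ^ (N - i) * (X + C 1) ^ i)
        - (X - 1) * ((d + N).choose N : ℤ[X]) := by
    rw [umbralSumRev, mul_sum, sum_range_succ, sum_range_succ]
    rw [umbral_shift, tsub_self, if_pos rfl, sum_congr rfl fun i hi => by
      rw [umbral_shift, if_neg (by have := mem_range.1 hi; omega)]]
    simp only [mul_zero, sub_zero]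
    rw [sum_congr rfl fun i _ => mul_left_comm _ _ _]
    ring
  have hsplit : ∑ k ∈ range (N + 1), ((N + 1 + d).choose k : ℤ[X]) * (eulerian (X : ℤ[X]) k
      * (((N + 1 + d - k - 1).choose (N + 1 - k - 1) : ℤ[X]) * (X ^ (N + 1 - k) - X)))
      = X * umbralSum X (fun i => ((d + i).choose i : ℤ[X])) N
        - X * ∑ i ∈ range (N + 1), ((d + i).choose i : ℤ[X])
          * umbral X (X ^ (N - i) * (X + C 1) ^ i) := by
    rw [umbralSum, hE, hQ, mul_sum, mul_sum, ← sum_sub_distrib]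
    refine sum_congr rfl fun k hk => ?_
    have hk' : k ≤ N := by have := mem_range.1 hk; omega
    have e1 : N + 1 - k - 1 = N - k := by omega
    have e2 : N + 1 - k = (N - k) + 1 := by omega
    rw [e1, e2, one_pow, pow_succ]
    push_cast
    ring
  rw [hsplit] at h1
  have e3 : N + 1 + d - 0 - 1 = d + N := by omega
  have e4 : N + 1 - 0 - 1 = N := by omega
  rw [e3, e4] at h1
  rw [hrev]
  change (X - 1) * dualChow (flatsRank (uniformMatroid (N + 1) (N + 1 + d))) ⊥ ⊤ = _
  linear_combination -h1

theorem dualAugChowPolynomial_eq :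
    dualAugChowPolynomial (uniformMatroid (N + 1) (N + 1 + d))
      = dualChowPolynomial (uniformMatroid (N + 1) (N + 1 + d))
        + X * umbralSum X (fun i => ((d + i).choose i : ℤ[X])) N := by
  classical
  have hrn : N + 1 ≤ N + 1 + d := by omega
  have h1 := dualAugChow_apply (flatsRank (uniformMatroid (N + 1) (N + 1 + d))) ⊥ ⊤
  rw [Icc_eq_cons_Ico bot_le, sum_cons, sum_congr rfl fun w hw => by
    rw [dualChow_bot_of_ne_top hrn (mem_Ico.1 hw).2.ne, sgn_mu_top hrn (mem_Ico.1 hw).2.ne,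
      flatsRank_rk_top hrn (mem_Ico.1 hw).2.ne], WeakRank.self, pow_zero,
    sum_Ico_bot_top (Nat.succ_pos N) hrn fun k => eulerian (X : ℤ[X]) k
      * (((N + 1 + d - k - 1).choose (N + 1 - k - 1) : ℤ[X]) * X ^ (N + 1 - k))] at h1
  have hd : sgn (flatsRank (uniformMatroid (N + 1) (N + 1 + d))) (IncidenceAlgebra.mu ℤ[X]) ⊤ ⊤
      = 1 := by
    simp [sgn, WeakRank.self]
  rw [hd, mul_one, mul_one] at h1
  refine h1.trans (congrArg₂ (· + ·) rfl ?_)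
  rw [umbralSum, sum_choose_mul_umbral, mul_sum]
  refine sum_congr rfl fun k hk => ?_
  have hk' : k ≤ N := by have := mem_range.1 hk; omega
  have e1 : N + 1 - k - 1 = N - k := by omega
  have e2 : N + 1 - k = (N - k) + 1 := by omega
  rw [e1, e2, pow_succ]
  push_cast
  ring

theorem realRooted_iff_map (p : ℤ[X]) : RealRooted p ↔
    ∀ z : ℂ, aeval z (p.map (Int.castRingHom ℝ)) = 0 → z.im = 0 := by
  have : ∀ z : ℂ, aeval z (p.map (Int.castRingHom ℝ)) = aeval z p := fun z =>
    aeval_map_algebraMap ℝ z p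
  simp only [RealRooted, this]

theorem realRooted_dualChowPolynomial (hN : 0 < N) :
    RealRooted (dualChowPolynomial (uniformMatroid (N + 1) (N + 1 + d))) := by
  rw [realRooted_iff_map]
  have h := congrArg (mapRingHom (Int.castRingHom ℝ)) (X_sub_one_mul_dualChowPolynomial d N)
  simp only [map_mul, map_sub, map_umbralSum, map_umbralSumRev, map_one, map_natCast,
    coe_mapRingHom, map_X] at h
  refine im_eq_zero_of_mul_eq_X_mul_umbralSum_sub (w := fun i => ((d + i).choose i : ℝ)) hN
    (fun i _ => Nat.cast_nonneg _) (by exact_mod_cast Nat.choose_pos (by omega)) ?_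
  simpa only [map_natCast] using h

theorem realRooted_dualAugChowPolynomial (hN : 0 < N) :
    RealRooted (dualAugChowPolynomial (uniformMatroid (N + 1) (N + 1 + d))) := by
  rw [realRooted_iff_map]
  have h0 : (X - 1) * dualAugChowPolynomial (uniformMatroid (N + 1) (N + 1 + d))
      = X ^ 2 * umbralSum X (fun i => ((d + i).choose i : ℤ[X])) N
        - umbralSumRev X (fun i => ((d + i).choose i : ℤ[X])) N := by
    rw [dualAugChowPolynomial_eq]
    linear_combination X_sub_one_mul_dualChowPolynomial d N
  have h := congrArg (mapRingHom (Int.castRingHom ℝ)) h0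
  simp only [map_mul, map_sub, map_pow, map_umbralSum, map_umbralSumRev, map_one, map_natCast,
    coe_mapRingHom, map_X] at h
  refine im_eq_zero_of_mul_eq_X_sq_mul_umbralSum_sub (w := fun i => ((d + i).choose i : ℝ)) hN
    (fun i _ => Nat.cast_nonneg _) (by exact_mod_cast Nat.choose_pos (by omega)) ?_
  simpa only [map_natCast] using h

theorem dualChowPolynomial_rank_one :
    dualChowPolynomial (uniformMatroid (0 + 1) (0 + 1 + d)) = 1 := by
  have h := X_sub_one_mul_dualChowPolynomial d 0
  have h1 : ((X : ℤ[X]) - 1) ≠ 0 := X_sub_C_ne_zero 1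
  refine mul_left_cancel₀ h1 (h.trans ?_)
  have : umbral (X : ℤ[X]) 1 = 1 := by simpa using umbral_X_pow (X : ℤ[X]) 0
  simp [umbralSum, umbralSumRev, this]

theorem dualAugChowPolynomial_rank_one :
    dualAugChowPolynomial (uniformMatroid (0 + 1) (0 + 1 + d)) = 1 + X := by
  rw [dualAugChowPolynomial_eq, dualChowPolynomial_rank_one]
  have : umbral (X : ℤ[X]) 1 = 1 := by simpa using umbral_X_pow (X : ℤ[X]) 0
  simp [umbralSum, this]

theorem dualChowPolynomial_rank_zero (n : ℕ) : dualChowPolynomial (uniformMatroid 0 n) = 1 ∧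
    dualAugChowPolynomial (uniformMatroid 0 n) = 1 := by
  classical
  have hbt : (⊤ : Flats (uniformMatroid 0 n)) = ⊥ := by
    by_contra h
    exact absurd (Flats.ncard_lt (Ne.symm h)) (Nat.not_lt_zero _)
  constructor
  · rw [dualChowPolynomial, hbt, dualChow_self]
  · rw [dualAugChowPolynomial, hbt, dualAugChow_apply, Icc_self, sum_singleton, dualChow_self]
    simp [sgn, WeakRank.self]

end RealRootedness
end DualChow

end

theorem mainTheorem9 (r n : ℕ) (hrn : r ≤ n) :
    DualChow.RealRooted (DualChow.dualChowPolynomial (DualChow.uniformMatroid r n)) ∧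
      DualChow.RealRooted (DualChow.dualAugChowPolynomial (DualChow.uniformMatroid r n)) := by
  obtain ⟨d, rfl⟩ := Nat.exists_eq_add_of_le hrn
  rcases r with _ | _ | N
  · obtain ⟨h1, h2⟩ := DualChow.dualChowPolynomial_rank_zero (0 + d)
    rw [h1, h2]
    constructor <;> intro z hz <;> simp at hz
  · rw [DualChow.dualChowPolynomial_rank_one, DualChow.dualAugChowPolynomial_rank_one]
    refine ⟨fun z hz => by simp at hz, fun z hz => ?_⟩
    have h : z = -1 := by
      simp only [map_add, map_one, Polynomial.aeval_X] at hz
      linear_combination hz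
    simp [h]
  · exact ⟨DualChow.realRooted_dualChowPolynomial d (N + 1) N.succ_pos,
      DualChow.realRooted_dualAugChowPolynomial d (N + 1) N.succ_pos⟩
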